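/- All graphs are finite and simple, "contains" refers to induced subgraphs, a path in $G$ is an induced path of $G$ (its length is its number of edges), and a hole is an induced cycle of length at least four. The $(t\times t)$-wall is the graph obtained from the $t\times 2t$ grid with rows $0,\dots,t-1$ and columns $0,\dots,2t-1$ by deleting, for every $i$, the edges between rows $i$ and $i+1$ that lie in columns $j$ with $i+j$ odd, and then deleting all vertices of degree one. A graph is $t$-clean if it contains no induced subgraph isomorphic to $K_t$, to $K_{t,t}$, to a subdivision of the $(t\times t)$-wall, or to the line graph of a subdivision of the $(t\times t)$-wall. A strong $k$-block in $G$ is a set $B$ of at least $k$ vertices such that one can choose, for every $2$-subset $\{x,y\}$ of $B$, a collection $\mathcal P_{\{x,y\}}$ of at least $k$ distinct, pairwise internally disjoint paths in $G$ from $x$ to $y$, in such a way that $P\cap P'=\{x,y\}\cap\{x',y'\}$ for all distinct $2$-subsets $\{x,y\},\{x',y'\}$ of $B$ and all $P\in\mathcal P_{\{x,y\}}$, $P'\in\mathcal P_{\{x',y'\}}$. A $d$-stable set in $G$ is a set $S$ of vertices such that no two distinct vertices of $S$ are joined by a path of length at most $d$ in $G$. Let $S_{\delta,\lambda}$ be the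 graph obtained from the star $K_{1,\delta}$ by replacing each edge by a path of length $\lambda$, rooted at the centre of the star, and let $\theta S_{\delta,\lambda}$ be the disjoint union of $\theta$ copies of it. An $S$-planted copy of $\theta S_{\delta,\lambda}$ in $G$ is an induced subgraph of $G$ isomorphic to $\theta S_{\delta,\lambda}$ in which all $\theta$ roots belong to $S$. **Theorem.** For all positive integers $d,k,t,\delta,\lambda,\theta$ with $\delta\ge 2$ there is a positive integer $k_1=k_1(d,k,t,\delta,\lambda,\theta)$ with the following property. Let $G$ be a $t$-clean graph and let $B_1$ be a strong $k_1$-block in $G$. Then there exist $A\subseteq V(G)$ and $S\subseteq B_1\setminus A$ such that 1. $S$ is both a strong $k$-block and a $d$-stable set in $G\setminus A$; 2. $G\setminus A$ contains an $S$-planted copy of $\theta S_{\delta,\lambda}$; 3. $G\setminus A$ contains a hole of length greater than $\lambda$. In particular (with the same $k_1$), every $t$-clean graph that does not contain $\theta S_{\delta,\lambda}$ as an induced subgraph has no strong $k_1$-block, and every $t$-clean graph that has no hole of length greater than $\lambda$ has no strong $k_1$-block. -/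

import Mathlib

open scoped SimpleGraph

universe u

/-- `IsSubdivision W H`: the graph `H` is (isomorphic to) a subdivision of `W`, that is, `H` arises
from `W` by replacing the edges of `W` by pairwise internally disjoint paths between their ends.
`b` sends the vertices of `W` to the corresponding vertices of `H`, and `P h` is the path that
replaces the edge `h` of `W`. -/
def IsSubdivision {α β : Type*} (W : SimpleGraph α) (H : SimpleGraph β) : Prop :=
  ∃ (b : α ↪ β) (P : ∀ ⦃u v : α⦄, W.Adj u v → H.Walk (b u) (b v)),
    (∀ ⦃u v : α⦄ (h : W.Adj u v), (P h).IsPath) ∧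
    -- the path depends only on the edge, up to the direction of traversal
    (∀ ⦃u v : α⦄ (h : W.Adj u v), P h.symm = (P h).reverse) ∧
    -- no vertex of `W` lies in the interior of a path
    (∀ ⦃u v : α⦄ (h : W.Adj u v) (w : α), b w ∈ (P h).support → w = u ∨ w = v) ∧
    -- paths replacing different edges share no interior vertex
    (∀ ⦃u v u' v' : α⦄ (h : W.Adj u v) (h' : W.Adj u' v'), s(u, v) ≠ s(u', v') →
      ∀ x : β, x ∈ (P h).support → x ∈ (P h').support → x ∈ Set.range b) ∧
    -- `H` has no further vertices or edges
    (∀ x : β, x ∈ Set.range b ∨ ∃ (u v : α) (h : W.Adj u v), x ∈ (P h).support) ∧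
    (∀ e ∈ H.edgeSet, ∃ (u v : α) (h : W.Adj u v), e ∈ (P h).edges)

/-- The `t × 2t` grid in which, of the vertical edges between rows `i` and `i + 1`, only those in
the columns `j` with `i + j` even are kept. -/
def brickGrid (t : ℕ) : SimpleGraph (Fin t × Fin (2 * t)) :=
  SimpleGraph.fromRel fun p q =>
    (p.1 = q.1 ∧ (p.2 : ℕ) + 1 = q.2) ∨
    (p.2 = q.2 ∧ (p.1 : ℕ) + 1 = q.1 ∧ Even ((p.1 : ℕ) + (p.2 : ℕ)))

/-- The `(t × t)`-wall: the brick grid without its vertices of degree one. -/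
def wall (t : ℕ) : SimpleGraph {v : Fin t × Fin (2 * t) | ((brickGrid t).neighborSet v).ncard ≠ 1} :=
  (brickGrid t).induce _

/-- `G` is `t`-clean: no induced subgraph of `G` is isomorphic to `K_t`, to `K_{t,t}`, to a
subdivision of the `(t × t)`-wall, or to the line graph of a subdivision of the `(t × t)`-wall. -/
def IsTClean {V : Type*} (t : ℕ) (G : SimpleGraph V) : Prop :=
  ¬ (⊤ : SimpleGraph (Fin t)) ⊴ G ∧
  ¬ completeBipartiteGraph (Fin t) (Fin t) ⊴ G ∧
  ∀ (n : ℕ) (H : SimpleGraph (Fin n)), IsSubdivision (wall t) H →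
    ¬ H ⊴ G ∧ ¬ H.lineGraph ⊴ G

/-- `P` is the vertex set of an induced path in `G` from `x` to `y` of length `ℓ`. An induced path
is determined by its vertex set. -/
def IsInducedPath {V : Type*} (G : SimpleGraph V) (x y : V) (ℓ : ℕ) (P : Set V) : Prop :=
  ∃ w : G.Walk x y, w.IsPath ∧ w.IsChordless ∧ w.length = ℓ ∧ P = {v | v ∈ w.support}

/-- `B` is a strong `k`-block in `G`: it has at least `k` vertices, and to every `2`-subset `{x, y}`
of `B` one can assign a collection `𝓠 s(x, y)` of at least `k` distinct, pairwise internally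
disjoint (induced) paths from `x` to `y`, such that paths assigned to different `2`-subsets meet
only in the common elements of these `2`-subsets. -/
def IsStrongBlock {V : Type*} (k : ℕ) (G : SimpleGraph V) (B : Set V) : Prop :=
  (k : ℕ∞) ≤ B.encard ∧
  ∃ 𝓠 : Sym2 V → Set (Set V),
    (∀ x ∈ B, ∀ y ∈ B, x ≠ y →
      (k : ℕ∞) ≤ (𝓠 s(x, y)).encard ∧
      (∀ P ∈ 𝓠 s(x, y), ∃ ℓ, IsInducedPath G x y ℓ P) ∧
      ∀ P ∈ 𝓠 s(x, y), ∀ Q ∈ 𝓠 s(x, y), P ≠ Q → P ∩ Q = {x, y}) ∧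
    ∀ x ∈ B, ∀ y ∈ B, ∀ x' ∈ B, ∀ y' ∈ B, x ≠ y → x' ≠ y' → s(x, y) ≠ s(x', y') →
      ∀ P ∈ 𝓠 s(x, y), ∀ P' ∈ 𝓠 s(x', y'), P ∩ P' = {x, y} ∩ {x', y'}

/-- `S` is a `d`-stable set in `G`: there is no path of length at most `d` in `G` between two
distinct vertices of `S`. -/
def IsDStable {V : Type*} (d : ℕ) (G : SimpleGraph V) (S : Set V) : Prop :=
  ∀ u ∈ S, ∀ v ∈ S, u ≠ v → ¬ ∃ (ℓ : ℕ) (P : Set V), IsInducedPath G u v ℓ P ∧ ℓ ≤ d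

/-- The disjoint union of `θ` copies of the `(l - 1)`-subdivision of the star `K_{1,δ}` (`1 ≤ l`).
In copy `c`, the centre is `(c, none)`, and `(c, some (i, j))` is the vertex at distance `j + 1`
from the centre on leg `i`. -/
def starForest (θ δ l : ℕ) : SimpleGraph (Fin θ × Option (Fin δ × Fin l)) :=
  SimpleGraph.fromRel fun p q => p.1 = q.1 ∧
    match p.2, q.2 with
    | none, some (_, j) => (j : ℕ) = 0
    | some (i, j), some (i', j') => i = i' ∧ (j : ℕ) + 1 = j'
    | _, none => False

/-- `G` contains an induced copy of `starForest θ δ l` in which the centres (the roots) of all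
components belong to `S`. -/
def HasPlantedStarForest {V : Type*} (θ δ l : ℕ) (G : SimpleGraph V) (S : Set V) : Prop :=
  ∃ f : starForest θ δ l ↪g G, ∀ c : Fin θ, f (c, none) ∈ S

/-- `G` contains a hole, that is, an induced cycle of length at least four, of length greater
than `l`. -/
def HasHoleLongerThan {V : Type*} (l : ℕ) (G : SimpleGraph V) : Prop :=
  ∃ n : ℕ, 4 ≤ n ∧ l < n ∧ SimpleGraph.cycleGraph n ⊴ G

/-! The proof rests on one principle, `exists_bound_of_robustlyLinked`. Two vertices are robustly
linked if a walk of bounded length joins them after the deletion of any boundedly many other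
vertices; a `t`-clean graph has no large set of pairwise robustly linked vertices. Otherwise a
greedy choice of paths yields a subdivided complete graph whose subdivided edges are short,
internally disjoint induced paths. Label a branch vertex by its index and an interior vertex by the
two indices of its path. Ramsey's theorem for quadruples of indices makes adjacency depend only on
the order pattern of the labels. A single edge between vertices with incomparable labels could then
be multiplied, by moving the private indices of its two ends independently, into a large biclique,
which is impossible without `K_t` and `K_{t,t}` (`exists_biclique_bound`,
`exists_homogeneous_index_set`). So on many indices there are no unwanted edges, and the paths that
correspond to the edges of the wall form an induced subdivision of the wall.

The principle is used twice. First, Ramsey's theorem for pairs finds many vertices of the block no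
two of which are robustly linked. For each pair a bounded set meets all short walks, and the union
of these sets, without the chosen vertices themselves, is the set `A` to delete
(`exists_far_apart`). A bounded deletion destroys boundedly many paths per pair, so the chosen
vertices still form a strong block (`IsStrongBlock.induce_compl`), now with large pairwise
distances. The initial segments of the paths at each root contain an induced subdivided star, again
by the homogeneous index set, and stars at distant roots do not interfere.

Second, let `x` and `y` be far apart and joined by many internally disjoint paths, and suppose that
there is no long hole. A shortest connection between the penultimate vertices of two of the paths
closes up through `y` to an induced cycle, so it is short, and it avoids `x` because `x` is far from
`y`. Among short walks from one penultimate vertex to many others, many leave a common hub and are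
disjoint beyond it (`exists_hub`); the hub lies on the first path. Hubs on many paths can be given
the same large set of targets (`exists_common_hubs`). Any two hubs are then joined through each of
these targets, hence robustly linked, against the principle. -/

/-! ### Ramsey's theorem for finite sets and increasing tuples -/

/-- One vertex at a time, extract a set on which the colour of an `(r + 1)`-set depends only on its
least element. -/
theorem exists_endHomogeneous {κ : Type*} {r : ℕ}
    (ih : ∀ M : ℕ, ∃ N : ℕ, ∀ (c : Finset ℕ → κ) (X : Finset ℕ), N ≤ X.card →
      ∃ Y ⊆ X, Y.card = M ∧ ∃ k, ∀ e ⊆ Y, e.card = r → c e = k) (m : ℕ) :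
    ∃ N : ℕ, ∀ (c : Finset ℕ → κ) (X : Finset ℕ), N ≤ X.card →
      ∃ Y ⊆ X, Y.card = m ∧ ∃ k : ℕ → κ, ∀ x ∈ Y, ∀ e ⊆ Y, e.card = r → (∀ z ∈ e, x < z) →
        c (insert x e) = k x := by
  induction m with
  | zero =>
    -- This only supplies some colour, as `κ` is not assumed nonempty here.
    obtain ⟨N, hN⟩ := ih 0
    refine ⟨max N 1, fun c X hX => ?_⟩
    obtain ⟨Y, hY, hc, k, hk⟩ := hN c X (le_trans (le_max_left _ _) hX)
    exact ⟨∅, by simp, by simp, fun _ => k, by simp⟩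
  | succ m IH =>
    obtain ⟨N₁, hN₁⟩ := IH
    obtain ⟨N, hN⟩ := ih N₁
    refine ⟨N + 1, fun c X hX => ?_⟩
    have hne : X.Nonempty := Finset.card_pos.mp (by omega)
    set x₀ := X.min' hne with hx₀
    have hx₀X : x₀ ∈ X := Finset.min'_mem _ _
    obtain ⟨Y₁, hY₁, hc₁, k₀, hk₀⟩ := hN (fun e => c (insert x₀ e)) (X.erase x₀)
      (by rw [Finset.card_erase_of_mem hx₀X]; omega)
    obtain ⟨Y, hY, hc, k, hk⟩ := hN₁ c Y₁ hc₁.ge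
    have hgt : ∀ z ∈ Y, x₀ < z := fun z hz => Finset.min'_lt_of_mem_erase_min' _ hne (hY₁ (hY hz))
    have hx₀Y : x₀ ∉ Y := fun h => lt_irrefl _ (hgt _ h)
    refine ⟨insert x₀ Y, ?_, by rw [Finset.card_insert_of_notMem hx₀Y, hc],
      fun x => if x = x₀ then k₀ else k x, ?_⟩
    · intro z hz
      rcases Finset.mem_insert.mp hz with rfl | hz
      · exact hx₀X
      · exact Finset.mem_of_mem_erase (hY₁ (hY hz))
    · intro x hx e he hcard hlt
      have heY : e ⊆ Y := by
        intro z hz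
        rcases Finset.mem_insert.mp (he hz) with rfl | h
        · rcases Finset.mem_insert.mp hx with rfl | hx
          · exact absurd (hlt _ hz) (lt_irrefl _)
          · exact absurd (hlt _ hz) (hgt _ hx).asymm
        · exact h
      rcases Finset.mem_insert.mp hx with rfl | hx
      · simpa using hk₀ e (heY.trans hY) hcard
      · simpa only [if_neg (hgt _ hx).ne'] using hk x hx e heY hcard hlt

/-- The finite Ramsey theorem for `r`-sets with finitely many colours. -/
theorem finite_ramsey (κ : Type*) [Finite κ] [Nonempty κ] (r : ℕ) : ∀ M : ℕ, ∃ N : ℕ,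
    ∀ (c : Finset ℕ → κ) (X : Finset ℕ), N ≤ X.card →
      ∃ Y ⊆ X, Y.card = M ∧ ∃ k, ∀ e ⊆ Y, e.card = r → c e = k := by
  classical
  induction r with
  | zero =>
    refine fun M => ⟨M, fun c X hX => ?_⟩
    obtain ⟨Y, hY, hc⟩ := Finset.exists_subset_card_eq hX
    exact ⟨Y, hY, hc, c ∅, fun e _ he => by rw [Finset.card_eq_zero.mp he]⟩
  | succ r ih =>
    intro M
    have := Fintype.ofFinite κ
    obtain ⟨N, hN⟩ := exists_endHomogeneous ih (Fintype.card κ * M)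
    refine ⟨N, fun c X hX => ?_⟩
    obtain ⟨Y, hY, hc, k, hk⟩ := hN c X hX
    -- The colour of an `(r + 1)`-set is now a function of its least element, so the pigeonhole
    -- principle on elements suffices.
    obtain ⟨a, -, ha⟩ := Finset.exists_le_card_fiber_of_mul_le_card_of_maps_to (s := Y)
      (t := (Finset.univ : Finset κ)) (f := k) (n := M) (by simp) Finset.univ_nonempty
      (by rw [Finset.card_univ, hc])
    obtain ⟨Z, hZ, hcZ⟩ := Finset.exists_subset_card_eq ha
    refine ⟨Z, (hZ.trans (Finset.filter_subset _ _)).trans hY, hcZ, a, fun e he hcard => ?_⟩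
    have hne : e.Nonempty := Finset.card_pos.mp (by omega)
    have hmem : e.min' hne ∈ e := Finset.min'_mem _ _
    have h := hk (e.min' hne) (Finset.mem_of_mem_filter _ (hZ (he hmem))) (e.erase (e.min' hne))
      (fun z hz => Finset.mem_of_mem_filter _ (hZ (he (Finset.mem_of_mem_erase hz))))
      (by rw [Finset.card_erase_of_mem hmem]; omega)
      (fun z hz => Finset.min'_lt_of_mem_erase_min' _ hne hz)
    rw [Finset.insert_erase hmem] at h
    rw [h]
    exact (Finset.mem_filter.mp (hZ (he hmem))).2

/-- The finite Ramsey theorem for colourings of increasing `r`-tuples. -/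
theorem finite_ramsey_tuple (κ : Type*) [Finite κ] [Nonempty κ] (r M : ℕ) : ∃ N : ℕ,
    ∀ C : (Fin r → ℕ) → κ, ∃ Y ⊆ Finset.range N, Y.card = M ∧
      ∃ k, ∀ φ : Fin r → ℕ, StrictMono φ → (∀ i, φ i ∈ Y) → C φ = k := by
  classical
  obtain ⟨N, hN⟩ := finite_ramsey κ r M
  refine ⟨N, fun C => ?_⟩
  obtain ⟨Y, hY, hc, k, hk⟩ := hN
    (fun e => if h : e.card = r then C (e.orderEmbOfFin h) else Classical.arbitrary κ)
    (Finset.range N) (by simp)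
  refine ⟨Y, hY, hc, k, fun φ hφ hmem => ?_⟩
  have hcard : (Finset.univ.image φ).card = r := by
    rw [Finset.card_image_of_injective _ hφ.injective, Finset.card_univ, Fintype.card_fin]
  have h := hk (Finset.univ.image φ) (by intro z hz; simp at hz; obtain ⟨i, rfl⟩ := hz; exact hmem i)
    hcard
  rw [dif_pos hcard, ← Finset.orderEmbOfFin_unique hcard (fun i => by simp) hφ] at h
  exact h

/-! ### Bicliques and homogeneous index sets -/

theorem isIndContained_of_fun {α V : Type*} {W : SimpleGraph α} {G : SimpleGraph V} (f : α → V)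
    (hf : Function.Injective f) (h : ∀ a b, G.Adj (f a) (f b) ↔ W.Adj a b) : W ⊴ G :=
  ⟨⟨⟨f, hf⟩, h _ _⟩⟩

/-- A graph with neither `K_t` nor `K_{t,t}` as an induced subgraph has no large complete bipartite
subgraph. -/
theorem exists_biclique_bound (t : ℕ) : ∃ s : ℕ, ∀ {V : Type u} (G : SimpleGraph V),
    ¬ (⊤ : SimpleGraph (Fin t)) ⊴ G → ¬ completeBipartiteGraph (Fin t) (Fin t) ⊴ G →
    ∀ f g : ℕ → V, Set.InjOn f (Set.Iio s) → Set.InjOn g (Set.Iio s) →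
      ¬ ∀ i < s, ∀ j < s, G.Adj (f i) (g j) := by
  obtain ⟨s, hs⟩ := finite_ramsey_tuple Prop 2 t
  refine ⟨s, fun G hK hB => ?_⟩
  -- Each side of a biclique contains a clique or a stable set of size `t`; cliques are excluded,
  -- and two stable sides give an induced `K_{t,t}`.
  have key : ∀ f : _, Set.InjOn f (Set.Iio s) → ∃ e : Fin t → ℕ, (∀ i, e i < s) ∧
      Function.Injective e ∧ ∀ i j, ¬ G.Adj (f (e i)) (f (e j)) := by
    intro f hf
    obtain ⟨Y, hY, hc, k, hk⟩ := hs (fun φ => G.Adj (f (φ 0)) (f (φ 1)))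
    have hlt : ∀ i, Y.orderEmbOfFin hc i < s := fun i =>
      Finset.mem_range.mp (hY (Y.orderEmbOfFin_mem hc i))
    have hadj : ∀ i j : Fin t, i < j →
        (G.Adj (f (Y.orderEmbOfFin hc i)) (f (Y.orderEmbOfFin hc j)) ↔ k) := by
      intro i j hij
      have h := hk ![Y.orderEmbOfFin hc i, Y.orderEmbOfFin hc j]
        (by
          intro a b hab
          have ha : a = 0 := by omega
          have hb : b = 1 := by omega
          subst ha hb
          simpa using hij)
        (by intro a; fin_cases a <;> simp)
      simpa using h
    by_cases hkk : k
    · refine absurd (isIndContained_of_fun (fun i => f (Y.orderEmbOfFin hc i)) ?_ ?_) hK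
      · intro i j hij
        exact (Y.orderEmbOfFin hc).injective (hf (hlt i) (hlt j) hij)
      · intro i j
        simp only [SimpleGraph.top_adj]
        rcases lt_trichotomy i j with h | h | h
        · simp [hadj i j h, hkk, h.ne]
        · simp [h]
        · rw [G.adj_comm]; simp [hadj j i h, hkk, h.ne']
    · refine ⟨fun i => Y.orderEmbOfFin hc i, hlt, (Y.orderEmbOfFin hc).injective, fun i j => ?_⟩
      rcases lt_trichotomy i j with h | h | h
      · simp [hadj i j h, hkk]
      · simp [h]
      · rw [G.adj_comm]; simp [hadj j i h, hkk]
  intro f g hf hg hall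
  obtain ⟨e, he, hei, hen⟩ := key f hf
  obtain ⟨e', he', hei', hen'⟩ := key g hg
  refine hB (isIndContained_of_fun (Sum.elim (fun i => f (e i)) (fun i => g (e' i))) ?_ ?_)
  · rintro (i | i) (j | j) hij
    · simpa using hei (hf (he i) (he j) hij)
    · exact absurd (hall _ (he i) _ (he' j)) (by simp at hij; simp [hij])
    · exact absurd (hall _ (he j) _ (he' i)) (by simp at hij; simp [hij])
    · simpa using hei' (hg (he' i) (he' j) hij)
  · rintro (i | i) (j | j)
    · simpa using hen i j
    · simpa using hall _ (he i) _ (he' j)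
    · simpa using (hall _ (he j) _ (he' i)).symm
    · simpa using hen' i j

/-- Let vertices `v i j a` be attached to index pairs `i ≤ j`. In a graph with neither `K_t` nor
`K_{t,t}`, after passing to a large set of indices there are no edges between vertices whose index
sets are incomparable. -/
theorem exists_homogeneous_index_set (t D M : ℕ) : ∃ N : ℕ, ∀ {V : Type u} (G : SimpleGraph V),
    ¬ (⊤ : SimpleGraph (Fin t)) ⊴ G → ¬ completeBipartiteGraph (Fin t) (Fin t) ⊴ G →
    ∀ (v : ℕ → ℕ → ℕ → V) (valid : ℕ → ℕ → ℕ → Prop),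
      (∀ i j a i' j' a', i ≤ j → j < N → i' ≤ j' → j' < N → a < D → a' < D →
        valid i j a → valid i' j' a' → v i j a = v i' j' a' → i = i' ∧ j = j') →
      ∃ Y ⊆ Finset.range N, Y.card = M ∧
        ∀ i ∈ Y, ∀ j ∈ Y, ∀ i' ∈ Y, ∀ j' ∈ Y, i ≤ j → i' ≤ j' →
          ¬ ({i, j} : Finset ℕ) ⊆ {i', j'} → ¬ ({i', j'} : Finset ℕ) ⊆ {i, j} →
          ∀ a < D, ∀ a' < D, valid i j a → valid i' j' a' → ¬ G.Adj (v i j a) (v i' j' a') := by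
  classical
  obtain ⟨s, hs⟩ := exists_biclique_bound.{u} t
  -- Two index pairs span at most four indices, so a colour of a quadruple records all adjacencies
  -- between vertices labelled by its entries. The size `4 * s + 4` leaves room for four blocks of
  -- `s + 1` indices.
  obtain ⟨N, hN⟩ := finite_ramsey_tuple
    ((Fin 4 × Fin 4 × Fin D) → (Fin 4 × Fin 4 × Fin D) → Prop) 4 (max M (4 * s + 4))
  refine ⟨N, fun G hK hB v valid hinj => ?_⟩
  obtain ⟨Y, hY, hc, k, hk⟩ := hN (fun φ o o' =>
    valid (φ o.1) (φ o.2.1) o.2.2 ∧ valid (φ o'.1) (φ o'.2.1) o'.2.2 ∧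
      G.Adj (v (φ o.1) (φ o.2.1) o.2.2) (v (φ o'.1) (φ o'.2.1) o'.2.2))
  obtain ⟨Y', hY', hcY'⟩ := Finset.exists_subset_card_eq (hc.symm ▸ le_max_left M (4 * s + 4))
  refine ⟨Y', hY'.trans hY, hcY', ?_⟩
  intro i hi j hj i' hi' j' hj' hij hij' hn hn' a ha a' ha' hv hv' hadj
  -- an increasing quadruple that contains the indices at hand
  obtain ⟨Q, hQ, hQY, hQc⟩ := Finset.exists_subsuperset_card_eq (s := {i, j, i', j'}) (t := Y)
    (n := 4) (by
      intro z hz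
      simp only [Finset.mem_insert, Finset.mem_singleton] at hz
      rcases hz with rfl | rfl | rfl | rfl <;> exact hY' ‹_›)
    Finset.card_le_four (by rw [hc]; exact le_trans (by omega) (le_max_right _ _))
  have hrk : ∀ z ∈ Q, ∃ ρ : Fin 4, Q.orderEmbOfFin hQc ρ = z := by
    intro z hz
    have : z ∈ Set.range (Q.orderEmbOfFin hQc) := by rw [Finset.range_orderEmbOfFin]; exact hz
    exact this
  obtain ⟨ri, hri⟩ := hrk i (hQ (by simp))
  obtain ⟨rj, hrj⟩ := hrk j (hQ (by simp))
  obtain ⟨ri', hri'⟩ := hrk i' (hQ (by simp))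
  obtain ⟨rj', hrj'⟩ := hrk j' (hQ (by simp))
  have hkval : k (ri, rj, ⟨a, ha⟩) (ri', rj', ⟨a', ha'⟩) := by
    rw [← hk (Q.orderEmbOfFin hQc) (Q.orderEmbOfFin hQc).strictMono
      (fun ρ => hQY (Q.orderEmbOfFin_mem hQc ρ))]
    simp only [hri, hrj, hri', hrj']
    exact ⟨hv, hv', hadj⟩
  have hle : ri ≤ rj := by rw [← (Q.orderEmbOfFin hQc).le_iff_le, hri, hrj]; exact hij
  have hle' : ri' ≤ rj' := by rw [← (Q.orderEmbOfFin hQc).le_iff_le, hri', hrj']; exact hij'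
  -- Incomparability gives each of the two pairs a private rank in the quadruple.
  have hn1 : ∃ ρ : Fin 4, (ρ = ri ∨ ρ = rj) ∧ ¬ (ρ = ri' ∨ ρ = rj') := by
    by_contra hcon
    push Not at hcon
    refine hn fun z hz => ?_
    simp only [Finset.mem_insert, Finset.mem_singleton] at hz ⊢
    rcases hz with rfl | rfl
    · rcases hcon ri (Or.inl rfl) with h | h
      · left; rw [← hri, ← hri', h]
      · right; rw [← hri, ← hrj', h]
    · rcases hcon rj (Or.inr rfl) with h | h
      · left; rw [← hrj, ← hri', h]
      · right; rw [← hrj, ← hrj', h]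
  have hn2 : ∃ ρ : Fin 4, (ρ = ri' ∨ ρ = rj') ∧ ¬ (ρ = ri ∨ ρ = rj) := by
    by_contra hcon
    push Not at hcon
    refine hn' fun z hz => ?_
    simp only [Finset.mem_insert, Finset.mem_singleton] at hz ⊢
    rcases hz with rfl | rfl
    · rcases hcon ri' (Or.inl rfl) with h | h
      · left; rw [← hri', ← hri, h]
      · right; rw [← hri', ← hrj, h]
    · rcases hcon rj' (Or.inr rfl) with h | h
      · left; rw [← hrj', ← hri, h]
      · right; rw [← hrj', ← hrj, h]
  -- vary the indices within blocks
  have hYc : 4 * s + 4 ≤ Y.card := by rw [hc]; exact le_max_right _ _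
  obtain ⟨Y₂, hY₂, hcY₂⟩ := Finset.exists_subset_card_eq hYc
  set y : ℕ → ℕ := fun n => if h : n < 4 * s + 4 then Y₂.orderEmbOfFin hcY₂ ⟨n, h⟩ else 0 with hy
  have hymem : ∀ n < 4 * s + 4, y n ∈ Y := by
    intro n hn; simp only [hy, dif_pos hn]; exact hY₂ (Finset.orderEmbOfFin_mem _ _ _)
  have hymono : ∀ m n, m < n → n < 4 * s + 4 → y m < y n := by
    intro m n hmn hn
    simp only [hy, dif_pos hn, dif_pos (hmn.trans hn)]
    simpa using hmn
  have hyinj : ∀ m n, m < 4 * s + 4 → n < 4 * s + 4 → y m = y n → m = n := by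
    intro m n hm hn h
    rcases lt_trichotomy m n with h' | h' | h'
    · exact absurd h (hymono _ _ h' hn).ne
    · exact h'
    · exact absurd h (hymono _ _ h' hm).ne'
  -- Ranks private to the first pair move by `α` within their block, those private to the second
  -- pair by `β`, and all others stay fixed. Hence the first vertex depends on `α` alone and the
  -- second on `β` alone.
  set off : ℕ → ℕ → Fin 4 → ℕ := fun α β ρ =>
    if ρ = ri ∨ ρ = rj then (if ρ = ri' ∨ ρ = rj' then 0 else α)
    else if ρ = ri' ∨ ρ = rj' then β else 0 with hoff
  have hofflt : ∀ α β ρ, α < s → β < s → off α β ρ ≤ s := by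
    intro α β ρ hα hβ; simp only [hoff]; split_ifs <;> omega
  set Φ : ℕ → ℕ → Fin 4 → ℕ := fun α β ρ => y (ρ * (s + 1) + off α β ρ) with hΦ
  have hbd : ∀ (α β : ℕ) (ρ : Fin 4), α < s → β < s → (ρ : ℕ) * (s + 1) + off α β ρ < 4 * s + 4 := by
    intro α β ρ hα hβ
    have h1 := hofflt α β ρ hα hβ
    have h2 : (ρ : ℕ) * (s + 1) ≤ 3 * (s + 1) := Nat.mul_le_mul_right _ (by omega)
    omega
  have hΦmono : ∀ α β, α < s → β < s → StrictMono (Φ α β) := by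
    intro α β hα hβ ρ σ hρσ
    refine hymono _ _ ?_ (hbd α β σ hα hβ)
    have h1 := hofflt α β ρ hα hβ
    have h2 : ((ρ : ℕ) + 1) * (s + 1) ≤ (σ : ℕ) * (s + 1) :=
      Nat.mul_le_mul_right _ (by exact_mod_cast hρσ)
    rw [add_mul] at h2
    omega
  have hΦmem : ∀ α β, α < s → β < s → ∀ ρ, Φ α β ρ ∈ Y := fun α β hα hβ ρ =>
    hymem _ (hbd α β ρ hα hβ)
  have hval : ∀ α β, α < s → β < s → valid (Φ α β ri) (Φ α β rj) a ∧
      valid (Φ α β ri') (Φ α β rj') a' ∧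
      G.Adj (v (Φ α β ri) (Φ α β rj) a) (v (Φ α β ri') (Φ α β rj') a') := by
    intro α β hα hβ
    have h := hk (Φ α β) (hΦmono α β hα hβ) (hΦmem α β hα hβ)
    rw [← h] at hkval
    exact hkval
  have hN' : ∀ α β, α < s → β < s → ∀ ρ, Φ α β ρ < N := fun α β hα hβ ρ =>
    Finset.mem_range.mp (hY (hΦmem α β hα hβ ρ))
  have hindep1 : ∀ α β β' ρ, (ρ = ri ∨ ρ = rj) → Φ α β ρ = Φ α β' ρ := by
    intro α β β' ρ hρ; simp only [hΦ, hoff, if_pos hρ]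
  have hindep2 : ∀ α α' β ρ, (ρ = ri' ∨ ρ = rj') → Φ α β ρ = Φ α' β ρ := by
    intro α α' β ρ hρ; simp only [hΦ, hoff, if_pos hρ]
  refine hs G hK hB (fun α => v (Φ α 0 ri) (Φ α 0 rj) a)
    (fun β => v (Φ 0 β ri') (Φ 0 β rj') a') ?_ ?_ ?_
  · intro α hα α' hα' heq
    simp only [Set.mem_Iio] at hα hα'
    have h0 : 0 < s := by omega
    obtain ⟨h1, h2⟩ := hinj _ _ _ _ _ _ ((hΦmono α 0 hα h0).monotone hle) (hN' α 0 hα h0 _)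
      ((hΦmono α' 0 hα' h0).monotone hle) (hN' α' 0 hα' h0 _) ha ha (hval α 0 hα h0).1
      (hval α' 0 hα' h0).1 heq
    obtain ⟨ρ, hρ, hρ'⟩ := hn1
    have h3 : Φ α 0 ρ = Φ α' 0 ρ := by rcases hρ with rfl | rfl <;> assumption
    have h4 := hyinj _ _ (hbd α 0 ρ hα h0) (hbd α' 0 ρ hα' h0) h3
    simp only [hoff, if_pos hρ, if_neg hρ'] at h4
    omega
  · intro β hβ β' hβ' heq
    simp only [Set.mem_Iio] at hβ hβ'
    have h0 : 0 < s := by omega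
    obtain ⟨h1, h2⟩ := hinj _ _ _ _ _ _ ((hΦmono 0 β h0 hβ).monotone hle') (hN' 0 β h0 hβ _)
      ((hΦmono 0 β' h0 hβ').monotone hle') (hN' 0 β' h0 hβ' _) ha' ha' (hval 0 β h0 hβ).2.1
      (hval 0 β' h0 hβ').2.1 heq
    obtain ⟨ρ, hρ, hρ'⟩ := hn2
    have h3 : Φ 0 β ρ = Φ 0 β' ρ := by rcases hρ with rfl | rfl <;> assumption
    have h4 := hyinj _ _ (hbd 0 β ρ h0 hβ) (hbd 0 β' ρ h0 hβ') h3
    simp only [hoff, if_pos hρ, if_neg hρ'] at h4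
    omega
  · intro α hα β hβ
    have h := (hval α β hα hβ).2.2
    rw [hindep1 α β 0 ri (Or.inl rfl), hindep1 α β 0 rj (Or.inr rfl),
      hindep2 α 0 β ri' (Or.inl rfl), hindep2 α 0 β rj' (Or.inr rfl)] at h
    exact h

/-! ### Induced paths as sequences of vertices -/

/-- `p 0, …, p n` are the vertices of an induced path of length `n`. -/
def IsPathFun {V : Type*} (G : SimpleGraph V) (n : ℕ) (p : ℕ → V) : Prop :=
  ∀ i ≤ n, ∀ j ≤ n, (p i = p j → i = j) ∧ (G.Adj (p i) (p j) ↔ i + 1 = j ∨ j + 1 = i)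

theorem exists_walk_of_adj {V : Type*} {G : SimpleGraph V} (n : ℕ) (p : ℕ → V)
    (h : ∀ i < n, G.Adj (p i) (p (i + 1))) :
    ∃ w : G.Walk (p 0) (p n), w.length = n ∧ ∀ i ≤ n, w.getVert i = p i := by
  induction n generalizing p with
  | zero => exact ⟨.nil, rfl, fun i hi => by simp [Nat.le_zero.mp hi]⟩
  | succ n ih =>
    obtain ⟨w, hw, hw'⟩ := ih (fun i => p (i + 1)) (fun i hi => h (i + 1) (by omega))
    refine ⟨.cons (h 0 (by omega)) w, by simp [hw], fun i hi => ?_⟩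
    rcases i with _ | i
    · simp
    · simpa using hw' i (by omega)

theorem IsPathFun.adj {V : Type*} {G : SimpleGraph V} {n : ℕ} {p : ℕ → V} (h : IsPathFun G n p)
    {i : ℕ} (hi : i < n) : G.Adj (p i) (p (i + 1)) :=
  (h i hi.le (i + 1) hi).2.mpr (Or.inl rfl)

theorem IsPathFun.exists_walk {V : Type*} {G : SimpleGraph V} {n : ℕ} {p : ℕ → V}
    (h : IsPathFun G n p) :
    ∃ w : G.Walk (p 0) (p n), w.length = n ∧ ∀ i ≤ n, w.getVert i = p i :=
  exists_walk_of_adj n p fun _ hi => h.adj hi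

theorem SimpleGraph.Walk.mem_support_iff_getVert {V : Type*} {G : SimpleGraph V} {x y z : V}
    (w : G.Walk x y) : z ∈ w.support ↔ ∃ i ≤ w.length, w.getVert i = z := by
  rw [SimpleGraph.Walk.mem_support_iff_exists_getVert]
  exact ⟨fun ⟨i, h, h'⟩ => ⟨i, h', h⟩, fun ⟨i, h, h'⟩ => ⟨i, h', h⟩⟩

theorem SimpleGraph.Walk.mem_edges_iff_getVert {V : Type*} {G : SimpleGraph V} {x y a b : V}
    (w : G.Walk x y) :
    s(a, b) ∈ w.edges ↔ ∃ i < w.length, s(w.getVert i, w.getVert (i + 1)) = s(a, b) := by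
  rw [← SimpleGraph.Walk.adj_toSubgraph_iff_mem_edges, SimpleGraph.Walk.toSubgraph_adj_iff]
  exact ⟨fun ⟨i, h, h'⟩ => ⟨i, h', h⟩, fun ⟨i, h, h'⟩ => ⟨i, h', h⟩⟩

/-- Chordlessness leaves only the edges between consecutive vertices, so adjacency along an induced
path becomes index arithmetic, the form in which paths and cycles are built below. -/
theorem isInducedPath_iff {V : Type*} {G : SimpleGraph V} {x y : V} {n : ℕ} {P : Set V} :
    IsInducedPath G x y n P ↔
      ∃ p : ℕ → V, IsPathFun G n p ∧ p 0 = x ∧ p n = y ∧ P = p '' Set.Iic n := by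
  constructor
  · rintro ⟨w, hw, hc, rfl, rfl⟩
    refine ⟨w.getVert, fun i hi j hj => ⟨fun h => hw.getVert_injOn hi hj h, fun h => ?_, ?_⟩,
      by simp, by simp, ?_⟩
    · have := hc.mem_edges (w.getVert_mem_support i) (w.getVert_mem_support j) h
      obtain ⟨k, hk, he⟩ := w.mem_edges_iff_getVert.mp this
      rcases Sym2.eq_iff.mp he with ⟨h1, h2⟩ | ⟨h1, h2⟩
      · have h1 := hw.getVert_injOn (by simp; omega) hi h1
        have h2 := hw.getVert_injOn (by simp; omega) hj h2
        omega
      · have h1 := hw.getVert_injOn (by simp; omega) hj h1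
        have h2 := hw.getVert_injOn (by simp; omega) hi h2
        omega
    · rintro (rfl | rfl)
      · exact w.adj_getVert_succ (by omega)
      · exact (w.adj_getVert_succ (by omega)).symm
    · ext z
      simp [w.mem_support_iff_getVert]
  · rintro ⟨p, hp, rfl, rfl, rfl⟩
    obtain ⟨w, hn, hw⟩ := hp.exists_walk
    refine ⟨w, ?_, ?_, hn, ?_⟩
    · rw [← SimpleGraph.Walk.IsPath.getVert_injOn_iff]
      intro i hi j hj h
      simp only [Set.mem_ofPred_eq, hn] at hi hj
      rw [hw i hi, hw j hj] at h
      exact (hp i hi j hj).1 h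
    · rw [SimpleGraph.Walk.isChordless_iff_forall_mem_edges]
      intro a b ha hb hab
      rw [w.mem_support_iff_getVert] at ha hb
      obtain ⟨i, hi, rfl⟩ := ha
      obtain ⟨j, hj, rfl⟩ := hb
      rw [hn] at hi hj
      rw [hw i hi, hw j hj] at hab
      rw [w.mem_edges_iff_getVert, hn]
      rcases (hp i hi j hj).2.mp hab with rfl | rfl
      · exact ⟨i, hj, rfl⟩
      · exact ⟨j, hi, Sym2.eq_swap⟩
    · ext z
      simp only [Set.mem_image, Set.mem_Iic, Set.mem_ofPred_eq, w.mem_support_iff_getVert, hn]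
      exact ⟨fun ⟨i, hi, h⟩ => ⟨i, hi, by rw [hw i hi, h]⟩,
        fun ⟨i, hi, h⟩ => ⟨i, hi, by rw [← hw i hi, h]⟩⟩

/-- Among the walks inside a set of vertices, a shortest one is an induced path. -/
theorem exists_pathFun_of_walk {V : Type*} {G : SimpleGraph V} {x y : V} (w : G.Walk x y)
    (T : Set V) (hT : ∀ z ∈ w.support, z ∈ T) :
    ∃ n ≤ w.length, ∃ p : ℕ → V, IsPathFun G n p ∧ p 0 = x ∧ p n = y ∧ ∀ i ≤ n, p i ∈ T := by
  classical
  have hex : ∃ n, ∃ w : G.Walk x y, w.length = n ∧ ∀ z ∈ w.support, z ∈ T := ⟨_, w, rfl, hT⟩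
  obtain ⟨q, hq, hqT⟩ := Nat.find_spec hex
  have hmin : ∀ q' : G.Walk x y, (∀ z ∈ q'.support, z ∈ T) → q.length ≤ q'.length := fun q' h =>
    hq ▸ Nat.find_min' hex ⟨q', rfl, h⟩
  -- Splicing `r` into `q` cannot shorten it; repeated vertices and chords would give such
  -- shortcuts.
  have hcut : ∀ i j, i < j → j ≤ q.length → ∀ r : G.Walk (q.getVert i) (q.getVert j),
      (∀ z ∈ r.support, z ∈ T) → j ≤ i + r.length := by
    intro i j hij hj r hr
    have h := hmin ((q.take i).append (r.append (q.drop j))) (by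
      intro z hz
      rcases SimpleGraph.Walk.mem_support_append_iff _ _ |>.mp hz with h | h
      · exact hqT z ((q.isSubwalk_take i).support_subset h)
      · rcases SimpleGraph.Walk.mem_support_append_iff _ _ |>.mp h with h | h
        · exact hr z h
        · exact hqT z ((q.isSubwalk_drop j).support_subset h))
    simp only [SimpleGraph.Walk.length_append, SimpleGraph.Walk.take_length,
      SimpleGraph.Walk.drop_length] at h
    omega
  have key : ∀ i j, i < j → j ≤ q.length → q.getVert i ≠ q.getVert j ∧
      (G.Adj (q.getVert i) (q.getVert j) ↔ i + 1 = j) := by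
    intro i j hij hj
    refine ⟨fun h => ?_, fun h => ?_, fun h => ?_⟩
    · have := hcut i j hij hj (SimpleGraph.Walk.nil.copy rfl h)
        (by simpa using hqT _ (q.getVert_mem_support i))
      simp at this
      omega
    · have := hcut i j hij hj h.toWalk (by
        intro z hz
        simp at hz
        rcases hz with rfl | rfl <;> exact hqT _ (q.getVert_mem_support _))
      simp at this
      omega
    · subst h
      exact q.adj_getVert_succ (by omega)
  refine ⟨q.length, hmin w hT, q.getVert, fun i hi j hj => ?_, by simp, by simp,
    fun i _ => hqT _ (q.getVert_mem_support i)⟩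
  rcases lt_trichotomy i j with h | rfl | h
  · have := key i j h hj
    refine ⟨fun h' => absurd h' this.1, this.2.trans ?_⟩
    omega
  · simp
  · have := key j i h hi
    refine ⟨fun h' => absurd h'.symm this.1, (G.adj_comm _ _).trans (this.2.trans ?_)⟩
    omega

/-! ### Robustly linked vertices and induced subdivisions -/

/-- `x` and `y` are joined by a walk of length at most `D` after the deletion of any `M` other
vertices. -/
def RobustlyLinked {V : Type*} (G : SimpleGraph V) (D M : ℕ) (x y : V) : Prop :=
  ∀ Z : Finset V, Z.card ≤ M → x ∉ Z → y ∉ Z →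
    ∃ w : G.Walk x y, w.length ≤ D ∧ ∀ z ∈ w.support, z ∉ Z

/-- Robustly linked vertices are the branch vertices of a subdivision of a complete graph whose
subdivided edges are short induced paths. -/
theorem exists_disjoint_pathFuns {V : Type*} (G : SimpleGraph V) (p D : ℕ) (b : ℕ → V)
    (h : ∀ i j, i < j → j < p → RobustlyLinked G D (p + p * p * (D + 1)) (b i) (b j)) :
    ∃ (n : ℕ → ℕ → ℕ) (q : ℕ → ℕ → ℕ → V), ∀ i j, i < j → j < p →
      n i j ≤ D ∧ IsPathFun G (n i j) (q i j) ∧ q i j 0 = b i ∧ q i j (n i j) = b j ∧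
      ∀ a, 0 < a → a < n i j → (∀ k < p, q i j a ≠ b k) ∧
        ∀ i' j', i' < j' → j' < p → ∀ a', 0 < a' → a' < n i' j' →
          q i j a = q i' j' a' → i = i' ∧ j = j' := by
  classical
  -- The paths are chosen greedily, one index pair at a time.
  suffices H : ∀ E : Finset (ℕ × ℕ), E ⊆ (Finset.range p ×ˢ Finset.range p).filter
      (fun e => e.1 < e.2) → ∃ (n : ℕ × ℕ → ℕ) (q : ℕ × ℕ → ℕ → V), ∀ e ∈ E,
      n e ≤ D ∧ IsPathFun G (n e) (q e) ∧ q e 0 = b e.1 ∧ q e (n e) = b e.2 ∧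
      ∀ a, 0 < a → a < n e → (∀ k < p, q e a ≠ b k) ∧
        ∀ e' ∈ E, ∀ a', 0 < a' → a' < n e' → q e a = q e' a' → e = e' by
    obtain ⟨n, q, hnq⟩ := H _ subset_rfl
    have hmem : ∀ i j, i < j → j < p → (i, j) ∈ (Finset.range p ×ˢ Finset.range p).filter
        (fun e => e.1 < e.2) := by
      intro i j hij hj
      simp only [Finset.mem_filter, Finset.mem_product, Finset.mem_range]
      exact ⟨⟨hij.trans hj, hj⟩, hij⟩
    refine ⟨fun i j => n (i, j), fun i j => q (i, j), fun i j hij hj => ?_⟩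
    obtain ⟨h1, h2, h3, h4, h5⟩ := hnq _ (hmem i j hij hj)
    refine ⟨h1, h2, h3, h4, fun a ha ha' => ⟨(h5 a ha ha').1, ?_⟩⟩
    intro i' j' hij' hj' a' ha1 ha2 heq
    simpa using (h5 a ha ha').2 _ (hmem i' j' hij' hj') a' ha1 ha2 heq
  intro E
  induction E using Finset.induction_on with
  | empty => exact fun _ => ⟨fun _ => 0, fun _ _ => b 0, by simp⟩
  | insert e E he ih =>
    intro hE
    obtain ⟨n, q, hnq⟩ := ih ((Finset.subset_insert _ _).trans hE)
    have heE := hE (Finset.mem_insert_self _ _)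
    simp only [Finset.mem_filter, Finset.mem_product, Finset.mem_range] at heE
    obtain ⟨⟨he1, he2⟩, hlt⟩ := heE
    -- The new path must avoid the other branch vertices and all earlier paths: at most `p`
    -- vertices, and at most `p * p` paths with at most `D + 1` vertices each.
    set Z : Finset V := (((Finset.range p).image b) ∪
      E.biUnion fun e' => (Finset.range (D + 1)).image (q e')) \ {b e.1, b e.2} with hZ
    have hEc : E.card ≤ p * p := by
      refine (Finset.card_le_card (((Finset.subset_insert _ _).trans hE).trans
        (Finset.filter_subset _ _))).trans ?_
      simp
    have hZc : Z.card ≤ p + p * p * (D + 1) := by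
      refine (Finset.card_le_card Finset.sdiff_subset).trans
        ((Finset.card_union_le _ _).trans (Nat.add_le_add ?_ ?_))
      · exact Finset.card_image_le.trans (by simp)
      · refine (Finset.card_biUnion_le_card_mul _ _ (D + 1) fun e' _ => ?_).trans
          (Nat.mul_le_mul_right _ hEc)
        exact Finset.card_image_le.trans (by simp)
    obtain ⟨w, hwD, hwZ⟩ := h e.1 e.2 hlt he2 Z hZc (by simp [hZ]) (by simp [hZ])
    obtain ⟨m, hm, r, hr, hr0, hrm, hrT⟩ := exists_pathFun_of_walk w {z | z ∉ Z} hwZ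
    have hint : ∀ a, 0 < a → a < m → r a ≠ b e.1 ∧ r a ≠ b e.2 := by
      intro a ha ham
      rw [← hr0, ← hrm]
      exact ⟨fun h' => by have := (hr a ham.le 0 (by omega)).1 h'; omega,
        fun h' => by have := (hr a ham.le m le_rfl).1 h'; omega⟩
    have hrE : ∀ a, 0 < a → a < m → (∀ k < p, r a ≠ b k) ∧
        ∀ e' ∈ E, ∀ a' ≤ D, r a ≠ q e' a' := by
      intro a ha ham
      have h1 : r a ∉ Z := hrT a ham.le
      have h2 := hint a ha ham
      refine ⟨fun k hk heq => h1 ?_, fun e' he' a' ha' heq => h1 ?_⟩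
      · rw [hZ, Finset.mem_sdiff]
        exact ⟨Finset.mem_union_left _ (Finset.mem_image.mpr ⟨k, by simpa using hk, heq.symm⟩),
          by simp [h2]⟩
      · rw [hZ, Finset.mem_sdiff]
        exact ⟨Finset.mem_union_right _ (Finset.mem_biUnion.mpr ⟨e', he', Finset.mem_image.mpr
          ⟨a', by simp; omega, heq.symm⟩⟩), by simp [h2]⟩
    have hne : ∀ e' ∈ E, e' ≠ e := fun e' he' h' => he (h' ▸ he')
    refine ⟨Function.update n e m, Function.update q e r, fun e' he' => ?_⟩
    rcases Finset.mem_insert.mp he' with rfl | he'E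
    · simp only [Function.update_self]
      refine ⟨hm.trans hwD, hr, hr0, hrm, fun a ha ham => ⟨(hrE a ha ham).1, ?_⟩⟩
      intro e'' he'' a' ha' ham' heq
      rcases Finset.mem_insert.mp he'' with rfl | he''
      · rfl
      · rw [Function.update_of_ne (hne _ he'')] at ham' heq
        exact absurd heq ((hrE a ha ham).2 e'' he'' a' (ham'.le.trans (hnq _ he'').1))
    · rw [Function.update_of_ne (hne _ he'E), Function.update_of_ne (hne _ he'E)]
      obtain ⟨h1, h2, h3, h4, h5⟩ := hnq e' he'E
      refine ⟨h1, h2, h3, h4, fun a ha ham => ⟨(h5 a ha ham).1, ?_⟩⟩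
      intro e'' he'' a' ha' ham' heq
      rcases Finset.mem_insert.mp he'' with rfl | he''
      · simp only [Function.update_self] at ham' heq
        exact absurd heq.symm ((hrE a' ha' ham').2 e' he'E a (ham.le.trans h1))
      · rw [Function.update_of_ne (hne _ he'')] at ham' heq
        exact (h5 a ha ham).2 e'' he'' a' ha' ham' heq

/-- A subdivision described by vertex sequences, one for each edge (oriented by means of `g`). -/
theorem isSubdivision_of_pathFun {α β : Type*} {W : SimpleGraph α} {H : SimpleGraph β}
    (g : α → ℕ) (hg : Function.Injective g) (b : α → β) (hb : Function.Injective b)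
    (n : α → α → ℕ) (q : α → α → ℕ → β)
    (hp : ∀ u v, W.Adj u v → g u < g v → IsPathFun H (n u v) (q u v) ∧ q u v 0 = b u ∧
      q u v (n u v) = b v)
    (hint : ∀ u v, W.Adj u v → g u < g v → ∀ a, 0 < a → a < n u v → (∀ w, q u v a ≠ b w) ∧
      ∀ u' v', W.Adj u' v' → g u' < g v' → ∀ a', 0 < a' → a' < n u' v' →
        q u v a = q u' v' a' → u = u' ∧ v = v')
    (hcov : ∀ x, x ∈ Set.range b ∨
      ∃ u v, W.Adj u v ∧ g u < g v ∧ ∃ a ≤ n u v, q u v a = x)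
    (hedge : ∀ x y, H.Adj x y → ∃ u v, W.Adj u v ∧ g u < g v ∧ ∃ a < n u v,
      s(q u v a, q u v (a + 1)) = s(x, y)) : IsSubdivision W H := by
  classical
  have hw : ∀ u v, W.Adj u v → g u < g v → ∃ w : H.Walk (b u) (b v), w.length = n u v ∧
      ∀ i ≤ n u v, w.getVert i = q u v i := by
    intro u v h hlt
    obtain ⟨h1, h2, h3⟩ := hp u v h hlt
    rw [← h2, ← h3]
    exact h1.exists_walk
  choose w hwl hwv using hw
  have hgt : ∀ {u v}, W.Adj u v → ¬ g u < g v → g v < g u := fun {u v} h hn =>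
    lt_of_le_of_ne (not_lt.mp hn) fun h' => h.ne (hg h'.symm)
  -- Using the reverse against the orientation by `g` builds in the symmetry required of the paths.
  set P : ∀ ⦃u v : α⦄, W.Adj u v → H.Walk (b u) (b v) := fun u v h =>
    if hl : g u < g v then w u v h hl else (w v u h.symm (hgt h hl)).reverse with hP
  have hPsup : ∀ {u v} (h : W.Adj u v), ∃ u' v', W.Adj u' v' ∧ g u' < g v' ∧
      s(u', v') = s(u, v) ∧ ∀ x, x ∈ (P h).support ↔ ∃ a ≤ n u' v', q u' v' a = x := by
    have hws : ∀ u v (h : W.Adj u v) (hl : g u < g v) x,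
        x ∈ (w u v h hl).support ↔ ∃ a ≤ n u v, q u v a = x := by
      intro u v h hl x
      rw [SimpleGraph.Walk.mem_support_iff_getVert, hwl]
      exact ⟨fun ⟨a, ha, he⟩ => ⟨a, ha, by rw [← hwv u v h hl a ha, he]⟩,
        fun ⟨a, ha, he⟩ => ⟨a, ha, by rw [hwv u v h hl a ha, he]⟩⟩
    intro u v h
    by_cases hl : g u < g v
    · exact ⟨u, v, h, hl, rfl, fun x => by simp only [hP, dif_pos hl]; exact hws u v h hl x⟩
    · refine ⟨v, u, h.symm, hgt h hl, Sym2.eq_swap, fun x => ?_⟩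
      simp only [hP, dif_neg hl, SimpleGraph.Walk.support_reverse, List.mem_reverse]
      exact hws v u h.symm (hgt h hl) x
  have hends : ∀ {u v}, W.Adj u v → g u < g v → ∀ a ≤ n u v,
      q u v a = b u ∨ q u v a = b v ∨ 0 < a ∧ a < n u v := by
    intro u v h hl a ha
    obtain ⟨-, h2, h3⟩ := hp u v h hl
    rcases Nat.eq_zero_or_pos a with rfl | h0
    · exact Or.inl h2
    · rcases ha.eq_or_lt with rfl | h1
      · exact Or.inr (Or.inl h3)
      · exact Or.inr (Or.inr ⟨h0, h1⟩)
  have hwpath : ∀ u v (h : W.Adj u v) (hl : g u < g v), (w u v h hl).IsPath := by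
    intro u v h hl
    rw [← SimpleGraph.Walk.IsPath.getVert_injOn_iff]
    intro i hi j hj heq
    simp only [Set.mem_ofPred_eq, hwl] at hi hj
    rw [hwv _ _ _ _ _ hi, hwv _ _ _ _ _ hj] at heq
    exact ((hp u v h hl).1 i hi j hj).1 heq
  refine ⟨⟨b, hb⟩, P, ?_, ?_, ?_, ?_, ?_, ?_⟩
  · intro u v h
    by_cases hl : g u < g v
    · simp only [hP, dif_pos hl]; exact hwpath u v h hl
    · simp only [hP, dif_neg hl]; exact (hwpath v u h.symm (hgt h hl)).reverse
  · intro u v h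
    by_cases hl : g u < g v
    · simp only [hP, dif_pos hl, dif_neg hl.asymm]
    · simp only [hP, dif_pos (hgt h hl), dif_neg hl, SimpleGraph.Walk.reverse_reverse]
  · intro u v h x hx
    obtain ⟨u', v', h', hl, hs, hsup⟩ := hPsup h
    obtain ⟨a, ha, hax⟩ := (hsup _).mp hx
    have : x = u' ∨ x = v' := by
      rcases hends h' hl a ha with h1 | h1 | ⟨h0, h1⟩
      · exact Or.inl (hb (hax.symm.trans h1))
      · exact Or.inr (hb (hax.symm.trans h1))
      · exact absurd hax ((hint u' v' h' hl a h0 h1).1 x)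
    rcases Sym2.eq_iff.mp hs with ⟨rfl, rfl⟩ | ⟨rfl, rfl⟩
    · exact this
    · exact this.symm
  · intro u v u' v' h h' hne x hx hx'
    obtain ⟨u₁, v₁, h₁, hl₁, hs₁, hsup₁⟩ := hPsup h
    obtain ⟨u₂, v₂, h₂, hl₂, hs₂, hsup₂⟩ := hPsup h'
    obtain ⟨a, ha, rfl⟩ := (hsup₁ _).mp hx
    obtain ⟨a', ha', hax⟩ := (hsup₂ _).mp hx'
    rcases hends h₁ hl₁ a ha with h3 | h3 | ⟨h3, h4⟩
    · exact ⟨u₁, h3.symm⟩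
    · exact ⟨v₁, h3.symm⟩
    rcases hends h₂ hl₂ a' ha' with h5 | h5 | ⟨h5, h6⟩
    · exact ⟨u₂, h5.symm.trans hax⟩
    · exact ⟨v₂, h5.symm.trans hax⟩
    obtain ⟨rfl, rfl⟩ := (hint u₁ v₁ h₁ hl₁ a h3 h4).2 u₂ v₂ h₂ hl₂ a' h5 h6 hax.symm
    exact absurd (hs₁.symm.trans hs₂) hne
  · intro x
    refine (hcov x).imp id ?_
    rintro ⟨u, v, h, hl, a, ha, rfl⟩
    refine ⟨u, v, h, ?_⟩
    simp only [hP, dif_pos hl]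
    rw [← hwv u v h hl a ha]
    exact SimpleGraph.Walk.getVert_mem_support _ _
  · intro e
    induction e using Sym2.ind with
    | _ x y =>
      intro he
      obtain ⟨u, v, h, hl, a, ha, hs⟩ := hedge x y he
      refine ⟨u, v, h, ?_⟩
      simp only [hP, dif_pos hl]
      rw [SimpleGraph.Walk.mem_edges_iff_getVert, hwl]
      refine ⟨a, ha, ?_⟩
      rw [hwv u v h hl a ha.le, hwv u v h hl (a + 1) ha, hs]

/-- In a graph that contains neither `K_t` nor `K_{t,t}` nor a subdivision of `W` as an induced
subgraph there is no large set of pairwise robustly linked vertices. -/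
theorem exists_bound_of_robustlyLinked {α : Type*} [Finite α] (W : SimpleGraph α) (t D : ℕ) :
    ∃ p M : ℕ, ∀ {V : Type u} (G : SimpleGraph V),
      ¬ (⊤ : SimpleGraph (Fin t)) ⊴ G → ¬ completeBipartiteGraph (Fin t) (Fin t) ⊴ G →
      (∀ (m : ℕ) (H : SimpleGraph (Fin m)), IsSubdivision W H → ¬ H ⊴ G) →
      ∀ b : ℕ → V, Set.InjOn b (Set.Iio p) →
        ¬ ∀ i j, i < j → j < p → RobustlyLinked G D M (b i) (b j) := by
  classical
  obtain ⟨p, hp⟩ := exists_homogeneous_index_set.{u} t (D + 1) (Nat.card α)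
  refine ⟨p, p + p * p * (D + 1), fun {V} G hK hB hW b hb hrob => ?_⟩
  obtain ⟨n, q, hnq⟩ := exists_disjoint_pathFuns G p D b hrob
  -- Branch vertices sit on the diagonal at position `0`, interior vertices at pairs `i < j`.
  -- Comparable labels belong to vertices of one chosen path, which is induced; edges between
  -- incomparable labels are what the homogeneous set excludes.
  obtain ⟨Y, hY, hYc, hhom⟩ := hp G hK hB (fun i j a => if i = j then b i else q i j a)
    (fun i j a => i = j ∧ a = 0 ∨ i < j ∧ 0 < a ∧ a < n i j) (by
      rintro i j a i' j' a' hij hj hij' hj' ha ha' (⟨rfl, rfl⟩ | ⟨h1, h2, h3⟩)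
        (⟨rfl, rfl⟩ | ⟨h1', h2', h3'⟩) heq
      · simp only [if_true] at heq
        exact ⟨hb hj hj' heq, hb hj hj' heq⟩
      · simp only [if_true, if_neg h1'.ne] at heq
        exact absurd heq.symm (((hnq i' j' h1' hj').2.2.2.2 a' h2' h3').1 i hj)
      · simp only [if_true, if_neg h1.ne] at heq
        exact absurd heq (((hnq i j h1 hj).2.2.2.2 a h2 h3).1 i' hj')
      · simp only [if_neg h1.ne, if_neg h1'.ne] at heq
        exact ((hnq i j h1 hj).2.2.2.2 a h2 h3).2 i' j' h1' hj' a' h2' h3' heq)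
  obtain ⟨g⟩ : Nonempty (α ≃ Y) := by
    have := Fintype.ofFinite α
    exact ⟨Fintype.equivOfCardEq (by rw [Fintype.card_coe, hYc, Nat.card_eq_fintype_card])⟩
  have hgY : ∀ u, (g u : ℕ) ∈ Y := fun u => (g u).2
  have hgp : ∀ u, (g u : ℕ) < p := fun u => Finset.mem_range.mp (hY (hgY u))
  have hginj : ∀ {u v}, (g u : ℕ) = g v → u = v := fun h => g.injective (Subtype.ext h)
  have hbb : ∀ u v, ¬ G.Adj (b (g u)) (b (g v)) := by
    intro u v hadj
    have hne : (g u : ℕ) ≠ g v := fun h => hadj.ne (by rw [h])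
    refine hhom _ (hgY u) _ (hgY u) _ (hgY v) _ (hgY v) le_rfl le_rfl (by simpa using hne)
      (by simpa using hne.symm) 0 (by omega) 0 (by omega) (Or.inl ⟨rfl, rfl⟩) (Or.inl ⟨rfl, rfl⟩) ?_
    simpa using hadj
  have hbq : ∀ u i j a, i ∈ Y → j ∈ Y → i < j → 0 < a → a < n i j →
      G.Adj (b (g u)) (q i j a) → ∃ c ≤ n i j, q i j c = b (g u) := by
    intro u i j a hi hj hij ha han hadj
    have hjp := Finset.mem_range.mp (hY hj)
    by_cases hmem : (g u : ℕ) = i ∨ (g u : ℕ) = j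
    · rcases hmem with h | h
      · exact ⟨0, by omega, by rw [(hnq i j hij hjp).2.2.1, h]⟩
      · exact ⟨n i j, le_rfl, by rw [(hnq i j hij hjp).2.2.2.1, h]⟩
    · exfalso
      refine hhom _ (hgY u) _ (hgY u) i hi j hj le_rfl hij.le (by simpa using hmem) ?_ 0 (by omega) a
        (by have := (hnq i j hij hjp).1; omega) (Or.inl ⟨rfl, rfl⟩) (Or.inr ⟨hij, ha, han⟩) ?_
      · intro hsub
        have h1 := hsub (Finset.mem_insert_self i {j})
        have h2 := hsub (Finset.mem_insert_of_mem (Finset.mem_singleton_self j))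
        simp at h1 h2
        omega
      · simpa [hij.ne] using hadj
  have hqq : ∀ i j a i' j' a', i ∈ Y → j ∈ Y → i' ∈ Y → j' ∈ Y → i < j → i' < j' → 0 < a →
      a < n i j → 0 < a' → a' < n i' j' → G.Adj (q i j a) (q i' j' a') → i = i' ∧ j = j' := by
    intro i j a i' j' a' hi hj hi' hj' hij hij' ha han ha' han' hadj
    have hpair : ∀ {i j i' j' : ℕ}, i < j → i' < j' → ({i, j} : Finset ℕ) ⊆ {i', j'} →
        i = i' ∧ j = j' := by
      intro i j i' j' hij hij' hsub
      have h1 := hsub (Finset.mem_insert_self i {j})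
      have h2 := hsub (Finset.mem_insert_of_mem (Finset.mem_singleton_self j))
      simp at h1 h2
      omega
    by_contra hne
    refine hhom i hi j hj i' hi' j' hj' hij.le hij'.le (fun h => hne (hpair hij hij' h))
      (fun h => hne ((hpair hij' hij h).imp Eq.symm Eq.symm)) a
      (by have := (hnq i j hij (Finset.mem_range.mp (hY hj))).1; omega) a'
      (by have := (hnq i' j' hij' (Finset.mem_range.mp (hY hj'))).1; omega)
      (Or.inr ⟨hij, ha, han⟩) (Or.inr ⟨hij', ha', han'⟩) ?_
    simpa [hij.ne, hij'.ne] using hadj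
  -- the vertex set of the induced subdivision
  set U : Set V := Set.range (fun u => b (g u)) ∪
    ⋃ e : α × α, {x | W.Adj e.1 e.2 ∧ (g e.1 : ℕ) < g e.2 ∧
      ∃ a ∈ Finset.Iic (n (g e.1) (g e.2)), q (g e.1) (g e.2) a = x} with hU
  have hUfin : U.Finite := by
    refine (Set.finite_range _).union (Set.finite_iUnion fun e => ?_)
    refine ((Finset.Iic (n (g e.1) (g e.2))).finite_toSet.image (q (g e.1) (g e.2))).subset ?_
    rintro x ⟨-, -, a, ha, rfl⟩
    exact ⟨a, ha, rfl⟩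
  -- The hypothesis `hW` concerns graphs on `Fin m`, so the finite set `U` is enumerated and the
  -- subdivision is transported along `f`.
  have := hUfin.to_subtype
  obtain ⟨m, ⟨ε⟩⟩ := Finite.exists_equiv_fin U
  set f : Fin m → V := fun y => ε.symm y with hf
  have hfinj : Function.Injective f := Subtype.val_injective.comp ε.symm.injective
  have hfU : ∀ x ∈ U, ∃ y, f y = x := fun x hx => ⟨ε ⟨x, hx⟩, by simp [hf]⟩
  have hfmem : ∀ y, f y ∈ U := fun y => (ε.symm y).2
  have hbU : ∀ u, ∃ y, f y = b (g u) := fun u => hfU _ (Or.inl ⟨u, rfl⟩)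
  choose b' hb' using hbU
  have hqU : ∀ u v a, ∃ y, W.Adj u v → (g u : ℕ) < g v → a ≤ n (g u) (g v) →
      f y = q (g u) (g v) a := by
    intro u v a
    by_cases h : W.Adj u v ∧ (g u : ℕ) < g v ∧ a ≤ n (g u) (g v)
    · obtain ⟨y, hy⟩ := hfU (q (g u) (g v) a) (Or.inr (Set.mem_iUnion.mpr
        ⟨(u, v), h.1, h.2.1, a, by simpa using h.2.2, rfl⟩))
      exact ⟨y, fun _ _ _ => hy⟩
    · exact ⟨b' u, fun h1 h2 h3 => absurd ⟨h1, h2, h3⟩ h⟩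
  choose q' hq' using hqU
  refine hW m (G.comap f) (isSubdivision_of_pathFun (fun u => (g u : ℕ)) (fun u v h => hginj h) b' ?_
    (fun u v => n (g u) (g v)) q' ?_ ?_ ?_ ?_)
    (isIndContained_of_fun f hfinj fun _ _ => Iff.rfl)
  · intro u v h
    have : b (g u) = b (g v) := by rw [← hb', ← hb', h]
    exact hginj (hb (hgp u) (hgp v) this)
  · intro u v h hl
    obtain ⟨-, h2, h3, h4, -⟩ := hnq (g u) (g v) hl (hgp v)
    refine ⟨fun i hi j hj => ?_, hfinj ?_, hfinj ?_⟩
    · rw [SimpleGraph.comap_adj, hq' u v i h hl hi, hq' u v j h hl hj, ← (h2 i hi j hj).2]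
      refine ⟨fun he => (h2 i hi j hj).1 ?_, Iff.rfl⟩
      rw [← hq' u v i h hl hi, ← hq' u v j h hl hj, he]
    · rw [hq' u v 0 h hl (Nat.zero_le _), hb', h3]
    · rw [hq' u v _ h hl le_rfl, hb', h4]
  · intro u v h hl a ha han
    obtain ⟨h5, h6⟩ := (hnq (g u) (g v) hl (hgp v)).2.2.2.2 a ha han
    refine ⟨fun w hw => h5 (g w) (hgp w) ?_, fun u' v' h' hl' a' ha' han' heq => ?_⟩
    · rw [← hb', ← hq' u v a h hl han.le, hw]
    · have := h6 (g u') (g v') hl' (hgp v') a' ha' han'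
        (by rw [← hq' u v a h hl han.le, ← hq' u' v' a' h' hl' han'.le, heq])
      exact ⟨hginj this.1, hginj this.2⟩
  · intro x
    rcases hfmem x with ⟨u, hu⟩ | hx
    · exact Or.inl ⟨u, hfinj ((hb' u).trans hu)⟩
    · obtain ⟨⟨u, v⟩, h, hl, a, ha, hax⟩ := Set.mem_iUnion.mp hx
      exact Or.inr ⟨u, v, h, hl, a, by simpa using ha,
        hfinj ((hq' u v a h hl (by simpa using ha)).trans hax)⟩
  · have hcons : ∀ u v, W.Adj u v → (g u : ℕ) < g v → ∀ x y : Fin m, G.Adj (f x) (f y) →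
        ∀ a ≤ n (g u) (g v), ∀ c ≤ n (g u) (g v), q (g u) (g v) a = f x → q (g u) (g v) c = f y →
        ∃ u v, W.Adj u v ∧ (g u : ℕ) < g v ∧ ∃ a < n (g u) (g v),
          s(q' u v a, q' u v (a + 1)) = s(x, y) := by
      intro u v h hl x y hadj a ha c hc hax hcy
      have hax' : q' u v a = x := hfinj ((hq' u v a h hl ha).trans hax)
      have hcy' : q' u v c = y := hfinj ((hq' u v c h hl hc).trans hcy)
      rw [← hax, ← hcy] at hadj
      rcases ((hnq (g u) (g v) hl (hgp v)).2.1 a ha c hc).2.mp hadj with rfl | rfl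
      · exact ⟨u, v, h, hl, a, by omega, by rw [hax', hcy']⟩
      · exact ⟨u, v, h, hl, c, by omega, by rw [hax', hcy', Sym2.eq_swap]⟩
    have hshape : ∀ x : Fin m, (∃ u, f x = b (g u)) ∨ ∃ u v, W.Adj u v ∧ (g u : ℕ) < g v ∧
        ∃ a, 0 < a ∧ a < n (g u) (g v) ∧ q (g u) (g v) a = f x := by
      intro x
      rcases hfmem x with ⟨u, hu⟩ | hx
      · exact Or.inl ⟨u, hu.symm⟩
      · obtain ⟨⟨u, v⟩, h, hl, a, ha, hax⟩ := Set.mem_iUnion.mp hx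
        obtain ⟨-, -, h3, h4, -⟩ := hnq (g u) (g v) hl (hgp v)
        simp only [Finset.mem_Iic] at h hl hax ha
        rcases Nat.eq_zero_or_pos a with rfl | h0
        · exact Or.inl ⟨u, by rw [← hax, h3]⟩
        · rcases ha.eq_or_lt with rfl | h1
          · exact Or.inl ⟨v, by rw [← hax, h4]⟩
          · exact Or.inr ⟨u, v, h, hl, a, h0, h1, hax⟩
    intro x y hadj
    rw [SimpleGraph.comap_adj] at hadj
    rcases hshape x with ⟨u, hu⟩ | ⟨u, v, h, hl, a, ha, han, hax⟩ <;>
      rcases hshape y with ⟨u', hu'⟩ | ⟨u', v', h', hl', a', ha', han', hax'⟩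
    · rw [hu, hu'] at hadj
      exact absurd hadj (hbb u u')
    · obtain ⟨c, hc, hcq⟩ := hbq u (g u') (g v') a' (hgY _) (hgY _) hl' ha' han'
        (by rw [← hu, hax']; exact hadj)
      exact hcons u' v' h' hl' x y hadj c hc a' han'.le (hcq.trans hu.symm) hax'
    · obtain ⟨c, hc, hcq⟩ := hbq u' (g u) (g v) a (hgY _) (hgY _) hl ha han
        (by rw [← hu', hax]; exact hadj.symm)
      exact hcons u v h hl x y hadj a han.le c hc hax (hcq.trans hu'.symm)
    · obtain ⟨h1, h2⟩ := hqq (g u) (g v) a (g u') (g v') a' (hgY _) (hgY _) (hgY _) (hgY _) hl hl'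
        ha han ha' han' (by rw [hax, hax']; exact hadj)
      obtain rfl := hginj h1
      obtain rfl := hginj h2
      exact hcons u v h hl x y hadj a han.le a' han'.le hax hax'

/-! ### Vertices far apart after a bounded deletion -/

/-- In a large set of vertices of a `t`-clean graph one finds `n` vertices that are pairwise far
apart after the deletion of a bounded number of other vertices. -/
theorem exists_far_apart (t d n : ℕ) : ∃ N m : ℕ, ∀ {V : Type u} (G : SimpleGraph V), IsTClean t G →
    ∀ b : ℕ → V, Set.InjOn b (Set.Iio N) → ∃ S A : Finset V, (S : Set V) ⊆ b '' Set.Iio N ∧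
      S.card = n ∧ A.card ≤ m ∧ Disjoint S A ∧ ∀ x ∈ S, ∀ y ∈ S, x ≠ y → ∀ w : G.Walk x y,
        (∀ z ∈ w.support, z ∉ A) → d < w.length := by
  classical
  obtain ⟨p, M, hpM⟩ := exists_bound_of_robustlyLinked.{u} (wall t) t d
  obtain ⟨N, hN⟩ := finite_ramsey_tuple Prop 2 (max n p)
  refine ⟨N, n * n * M, fun {V} G hG b hb => ?_⟩
  obtain ⟨Y, hY, hYc, k, hk⟩ := hN (fun φ => RobustlyLinked G d M (b (φ 0)) (b (φ 1)))
  have hkY : ∀ i ∈ Y, ∀ j ∈ Y, i < j → (RobustlyLinked G d M (b i) (b j) ↔ k) := by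
    intro i hi j hj hij
    have h := hk ![i, j]
      (by
        intro a c hac
        have ha : a = 0 := by omega
        have hc : c = 1 := by omega
        subst ha hc
        simpa using hij)
      (by intro a; fin_cases a <;> simpa)
    simpa using h
  have hYN : ∀ i ∈ Y, i < N := fun i hi => Finset.mem_range.mp (hY hi)
  by_cases hkk : k
  · exfalso
    have hpY : p ≤ Y.card := hYc.symm ▸ le_max_right n p
    obtain ⟨Y', hY', hYc'⟩ := Finset.exists_subset_card_eq hpY
    set y : ℕ → ℕ := fun i => if h : i < p then Y'.orderEmbOfFin hYc' ⟨i, h⟩ else 0 with hy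
    have hyY : ∀ i < p, y i ∈ Y := by
      intro i hi
      simp only [hy, dif_pos hi]
      exact hY' (Finset.orderEmbOfFin_mem _ _ _)
    refine hpM G hG.1 hG.2.1 (fun m H hH => (hG.2.2 m H hH).1) (fun i => b (y i)) ?_ ?_
    · intro i hi j hj h
      have h' := hb (hYN _ (hyY i hi)) (hYN _ (hyY j hj)) h
      simp only [Set.mem_Iio] at hi hj
      simp only [hy, dif_pos hi, dif_pos hj] at h'
      simpa using (Y'.orderEmbOfFin hYc').injective h'
    · intro i j hij hj
      refine (hkY _ (hyY i (hij.trans hj)) _ (hyY j hj) ?_).mpr hkk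
      simp only [hy, dif_pos hj, dif_pos (hij.trans hj)]
      simpa using hij
  obtain ⟨Y', hY', hYc'⟩ := Finset.exists_subset_card_eq (hYc.symm ▸ le_max_left n p)
  -- A pair that is not robustly linked has a set of at most `M` other vertices that meets every
  -- walk of length at most `d` between its members.
  have hZ : ∀ i j, ∃ Z : Finset V, Z.card ≤ M ∧ (i ∈ Y' → j ∈ Y' → i < j → b i ∉ Z ∧ b j ∉ Z ∧
      ∀ w : G.Walk (b i) (b j), w.length ≤ d → ∃ z ∈ w.support, z ∈ Z) := by
    intro i j
    by_cases h : i ∈ Y' ∧ j ∈ Y' ∧ i < j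
    · have hnr : ¬ RobustlyLinked G d M (b i) (b j) := fun h' =>
        hkk ((hkY i (hY' h.1) j (hY' h.2.1) h.2.2).mp h')
      unfold RobustlyLinked at hnr
      push Not at hnr
      obtain ⟨Z, h1, h2, h3, h4⟩ := hnr
      exact ⟨Z, h1, fun _ _ _ => ⟨h2, h3, h4⟩⟩
    · exact ⟨∅, by simp, fun h1 h2 h3 => absurd ⟨h1, h2, h3⟩ h⟩
  choose Z hZc hZ using hZ
  set S : Finset V := Y'.image b with hS
  -- The vertices of `S` must survive, although the set for one pair may contain members of others.
  set A : Finset V := ((Y' ×ˢ Y').biUnion fun e => Z e.1 e.2) \ S with hA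
  refine ⟨S, A, ?_, ?_, ?_, Finset.disjoint_sdiff, ?_⟩
  · rw [hS, Finset.coe_image]
    exact Set.image_mono fun i hi => hYN i (hY' hi)
  · rw [hS, Finset.card_image_of_injOn, hYc']
    exact hb.mono fun i hi => hYN i (hY' hi)
  · refine (Finset.card_le_card Finset.sdiff_subset).trans
      ((Finset.card_biUnion_le_card_mul _ _ M fun e _ => hZc _ _).trans ?_)
    rw [Finset.card_product, hYc']
  -- A short walk that avoids `A` still meets the separating set of its ends, necessarily in a third
  -- vertex of `S`. Cutting there gives a strictly shorter walk between two vertices of `S`, so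
  -- induction on the length applies.
  · have hmain : ∀ ℓ : ℕ, ∀ x ∈ S, ∀ y ∈ S, x ≠ y → ∀ w : G.Walk x y, w.length = ℓ →
        (∀ z ∈ w.support, z ∉ A) → d < ℓ := by
      intro ℓ
      induction ℓ using Nat.strong_induction_on with
      | _ ℓ ih =>
        intro x hx y hy hne w hw hwA
        obtain ⟨i, hi, rfl⟩ := Finset.mem_image.mp hx
        obtain ⟨j, hj, rfl⟩ := Finset.mem_image.mp hy
        by_contra hd
        have hz : ∃ z ∈ w.support, z ≠ b i ∧ z ≠ b j ∧
            z ∈ (Y' ×ˢ Y').biUnion fun e => Z e.1 e.2 := by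
          rcases lt_trichotomy i j with hij | rfl | hij
          · obtain ⟨h1, h2, h3⟩ := hZ i j hi hj hij
            obtain ⟨z, hz, hzZ⟩ := h3 w (by omega)
            exact ⟨z, hz, fun h => h1 (h ▸ hzZ), fun h => h2 (h ▸ hzZ),
              Finset.mem_biUnion.mpr ⟨(i, j), by simp [hi, hj], hzZ⟩⟩
          · exact absurd rfl hne
          · obtain ⟨h1, h2, h3⟩ := hZ j i hj hi hij
            obtain ⟨z, hz, hzZ⟩ := h3 w.reverse (by rw [SimpleGraph.Walk.length_reverse]; omega)
            exact ⟨z, by simpa using hz, fun h => h2 (h ▸ hzZ), fun h => h1 (h ▸ hzZ),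
              Finset.mem_biUnion.mpr ⟨(j, i), by simp [hi, hj], hzZ⟩⟩
        obtain ⟨z, hz, hzi, hzj, hzZ⟩ := hz
        have hzS : z ∈ S := by
          by_contra h
          exact hwA z hz (Finset.mem_sdiff.mpr ⟨hzZ, h⟩)
        have hlt := SimpleGraph.Walk.length_takeUntil_lt_length hz hzj
        have := ih _ (hw ▸ hlt) _ hx z hzS hzi.symm (w.takeUntil z hz) rfl
          fun a ha => hwA a (w.support_takeUntil_subset_support hz ha)
        omega
    exact fun x hx y hy hne w hwA => hmain _ x hx y hy hne w rfl hwA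

/-! ### Clean graphs and strong blocks under vertex deletion -/

theorem IsInducedPath.induce {V : Type*} {G : SimpleGraph V} {x y : V} {n : ℕ} {P T : Set V}
    (h : IsInducedPath G x y n P) (hPT : P ⊆ T) (hx : x ∈ T) (hy : y ∈ T) :
    IsInducedPath (G.induce T) ⟨x, hx⟩ ⟨y, hy⟩ n (Subtype.val ⁻¹' P) := by
  classical
  obtain ⟨p, hp, hp0, hpn, rfl⟩ := isInducedPath_iff.mp h
  have hpT : ∀ i ≤ n, p i ∈ T := fun i hi => hPT ⟨i, hi, rfl⟩
  set r : ℕ → T := fun i => if h : p i ∈ T then ⟨p i, h⟩ else ⟨x, hx⟩ with hr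
  have hrp : ∀ i ≤ n, (r i : V) = p i := fun i hi => by simp only [hr, dif_pos (hpT i hi)]
  refine isInducedPath_iff.mpr ⟨r, fun i hi j hj => ?_, ?_, ?_, ?_⟩
  · rw [SimpleGraph.induce_adj, hrp i hi, hrp j hj]
    refine ⟨fun he => (hp i hi j hj).1 ?_, (hp i hi j hj).2⟩
    rw [← hrp i hi, ← hrp j hj, he]
  · exact Subtype.ext ((hrp 0 (Nat.zero_le _)).trans hp0)
  · exact Subtype.ext ((hrp n le_rfl).trans hpn)
  · ext z
    simp only [Set.mem_preimage, Set.mem_image, Set.mem_Iic]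
    exact ⟨fun ⟨i, hi, h⟩ => ⟨i, hi, Subtype.ext ((hrp i hi).trans h)⟩,
      fun ⟨i, hi, h⟩ => ⟨i, hi, by rw [← hrp i hi, h]⟩⟩

theorem IsTClean.induce {V : Type*} {t : ℕ} {G : SimpleGraph V} (h : IsTClean t G) (T : Set V) :
    IsTClean t (G.induce T) := by
  have hT : G.induce T ⊴ G := ⟨SimpleGraph.Embedding.induce T⟩
  exact ⟨fun h' => h.1 (h'.trans hT), fun h' => h.2.1 (h'.trans hT), fun n H hH =>
    ⟨fun h' => (h.2.2 n H hH).1 (h'.trans hT), fun h' => (h.2.2 n H hH).2 (h'.trans hT)⟩⟩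

/-- Deleting few vertices from a strong block leaves a strong block. -/
theorem IsStrongBlock.induce_compl {V : Type*} {G : SimpleGraph V} {k₁ k : ℕ} {B S : Set V}
    (hB : IsStrongBlock k₁ G B) (A : Finset V) (hSB : S ⊆ B) (hSA : ∀ x ∈ S, x ∉ A)
    (hS : (k : ℕ∞) ≤ S.encard) (hk : k + A.card ≤ k₁) :
    IsStrongBlock k (G.induce (A : Set V)ᶜ) (Subtype.val ⁻¹' S) := by
  classical
  obtain ⟨-, 𝓠, h𝓠, hcross⟩ := hB
  have hmem : ∀ {x}, x ∈ S → x ∈ (A : Set V)ᶜ := fun hx => by simpa using hSA _ hx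
  have hval : ∀ P : Set V, P ⊆ (A : Set V)ᶜ →
      Subtype.val '' (Subtype.val ⁻¹' P : Set ((A : Set V)ᶜ : Set V)) = P := by
    intro P hP
    rw [Set.image_preimage_eq_inter_range, Subtype.range_coe]
    exact Set.inter_eq_left.mpr hP
  refine ⟨?_, fun e => (fun P => (Subtype.val ⁻¹' P : Set ((A : Set V)ᶜ : Set V))) ''
    {P | P ∈ 𝓠 (e.map Subtype.val) ∧ P ⊆ (A : Set V)ᶜ}, ?_, ?_⟩
  · rw [Set.encard_preimage_of_injective_subset_range Subtype.val_injective]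
    · exact hS
    · rw [Subtype.range_coe]
      exact fun x hx => hmem hx
  · rintro ⟨x, hxA⟩ hx ⟨y, hyA⟩ hy hne
    have hxy : x ≠ y := fun h => hne (Subtype.ext h)
    obtain ⟨h1, h2, h3⟩ := h𝓠 x (hSB hx) y (hSB hy) hxy
    simp only [Sym2.map_mk]
    refine ⟨?_, ?_, ?_⟩
    · rw [Set.InjOn.encard_image]
      -- Charge each destroyed path to a vertex of `A` on it. Two paths of the collection share only
      -- `x` and `y`, which lie outside `A`, so the charging is injective.
      · have hbad : ({P | P ∈ 𝓠 s(x, y) ∧ ¬ P ⊆ (A : Set V)ᶜ} : Set (Set V)).encard ≤ A.card := by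
          have hch : ∀ P : Set V, ∃ a : V, ¬ P ⊆ (A : Set V)ᶜ → a ∈ P ∧ a ∈ A := by
            intro P
            by_cases h : P ⊆ (A : Set V)ᶜ
            · exact ⟨x, fun h' => absurd h h'⟩
            · obtain ⟨a, ha, ha'⟩ := Set.not_subset.mp h
              exact ⟨a, fun _ => ⟨ha, by simpa using ha'⟩⟩
          choose a ha using hch
          rw [← Set.encard_coe_eq_coe_finsetCard]
          refine Set.encard_le_encard_of_injOn (f := a) (fun P hP => (ha P hP.2).2) ?_
          intro P hP Q hQ heq
          by_contra hPQ
          have : a P ∈ P ∩ Q := ⟨(ha P hP.2).1, heq ▸ (ha Q hQ.2).1⟩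
          rw [h3 P hP.1 Q hQ.1 hPQ] at this
          rcases this with h | h
          · exact hSA _ hx (h ▸ (ha P hP.2).2)
          · exact hSA _ hy (h ▸ (ha P hP.2).2)
        have hsum : (𝓠 s(x, y)).encard ≤ ({P | P ∈ 𝓠 s(x, y) ∧ P ⊆ (A : Set V)ᶜ}).encard +
            ({P | P ∈ 𝓠 s(x, y) ∧ ¬ P ⊆ (A : Set V)ᶜ} : Set (Set V)).encard := by
          refine (Set.encard_le_encard fun P hP => ?_).trans (Set.encard_union_le _ _)
          by_cases h : P ⊆ (A : Set V)ᶜ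
          · exact Or.inl ⟨hP, h⟩
          · exact Or.inr ⟨hP, h⟩
        have hfin : ((k : ℕ∞) + A.card) ≤
            ({P | P ∈ 𝓠 s(x, y) ∧ P ⊆ (A : Set V)ᶜ}).encard + A.card := by
          refine le_trans ?_ ((h1.trans hsum).trans (by gcongr))
          exact_mod_cast hk
        exact (ENat.add_le_add_iff_right (ENat.natCast_ne_top _)).mp hfin
      · intro P hP Q hQ heq
        rw [← hval P hP.2, ← hval Q hQ.2]
        exact congrArg _ heq
    · rintro _ ⟨P, ⟨hP, hPA⟩, rfl⟩
      obtain ⟨ℓ, hℓ⟩ := h2 P hP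
      exact ⟨ℓ, hℓ.induce hPA _ _⟩
    · rintro _ ⟨P, ⟨hP, hPA⟩, rfl⟩ _ ⟨Q, ⟨hQ, hQA⟩, rfl⟩ hPQ
      rw [← Set.preimage_inter, h3 P hP Q hQ fun h => hPQ (by rw [h])]
      ext z
      simp [Subtype.ext_iff]
  · rintro ⟨x, hxA⟩ hx ⟨y, hyA⟩ hy ⟨x', hxA'⟩ hx' ⟨y', hyA'⟩ hy' hne hne' hs
    rintro _ ⟨P, ⟨hP, hPA⟩, rfl⟩ _ ⟨Q, ⟨hQ, hQA⟩, rfl⟩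
    simp only [Sym2.map_mk] at hP hQ
    rw [← Set.preimage_inter, hcross x (hSB hx) y (hSB hy) x' (hSB hx') y' (hSB hy')
      (fun h => hne (Subtype.ext h)) (fun h => hne' (Subtype.ext h)) ?_ P hP Q hQ]
    · ext z
      simp [Subtype.ext_iff]
    · intro h
      refine hs (Sym2.map.injective Subtype.val_injective ?_)
      simpa only [Sym2.map_mk] using h

/-- Supplies the indexing by an initial segment of `ℕ` that the Ramsey-type lemmas work with; values
beyond it are arbitrary. -/
theorem exists_injOn_of_le_encard {α : Type*} [Nonempty α] {s : Set α} {N : ℕ}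
    (h : (N : ℕ∞) ≤ s.encard) :
    ∃ f : ℕ → α, Set.InjOn f (Set.Iio N) ∧ ∀ i < N, f i ∈ s := by
  classical
  obtain ⟨t, hts, htc⟩ := Set.exists_subset_encard_eq h
  have hfin : t.Finite := Set.finite_of_encard_eq_coe htc
  have hcard : hfin.toFinset.card = N := by
    have := hfin.encard_eq_coe_toFinset_card
    rw [htc] at this
    exact_mod_cast this.symm
  set e := hfin.toFinset.equivFinOfCardEq hcard with he
  refine ⟨fun i => if hi : i < N then e.symm ⟨i, hi⟩ else Classical.arbitrary α, ?_, ?_⟩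
  · intro i hi j hj hij
    simp only [Set.mem_Iio] at hi hj
    simp only [dif_pos hi, dif_pos hj] at hij
    simpa using e.symm.injective (Subtype.ext hij)
  · intro i hi
    simp only [dif_pos hi]
    exact hts (hfin.mem_toFinset.mp (e.symm ⟨i, hi⟩).2)

/-! ### Planted star forests -/

/-- Many internally disjoint long paths that start at `x` contain `δ` legs of length `l` at `x`
without edges between different legs. -/
theorem exists_anticomplete_legs (t δ l : ℕ) : ∃ N : ℕ, ∀ {V : Type u} (G : SimpleGraph V),
    ¬ (⊤ : SimpleGraph (Fin t)) ⊴ G → ¬ completeBipartiteGraph (Fin t) (Fin t) ⊴ G →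
    ∀ (x y : V) (𝓟 : Set (Set V)), (N : ℕ∞) ≤ 𝓟.encard →
      (∀ P ∈ 𝓟, ∃ n, l < n ∧ IsInducedPath G x y n P) →
      (∀ P ∈ 𝓟, ∀ Q ∈ 𝓟, P ≠ Q → P ∩ Q = {x, y}) →
      ∃ leg : Fin δ → ℕ → V, (∀ i, IsPathFun G l (leg i) ∧ leg i 0 = x) ∧
        ∀ i j, i ≠ j → ∀ a a', 0 < a → a ≤ l → 0 < a' → a' ≤ l →
          leg i a ≠ leg j a' ∧ ¬ G.Adj (leg i a) (leg j a') := by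
  classical
  obtain ⟨N, hN⟩ := exists_homogeneous_index_set.{u} t l δ
  refine ⟨N, fun {V} G hK hB x y 𝓟 h𝓟 hpath hdisj => ?_⟩
  obtain ⟨P, hPinj, hP𝓟⟩ := exists_injOn_of_le_encard h𝓟
  have hp : ∀ i, ∃ (n : ℕ) (p : ℕ → V), i < N → l < n ∧ IsPathFun G n p ∧ p 0 = x ∧ p n = y ∧
      P i = p '' Set.Iic n := by
    intro i
    by_cases hi : i < N
    · obtain ⟨n, hn, h⟩ := hpath _ (hP𝓟 i hi)
      obtain ⟨p, hp⟩ := isInducedPath_iff.mp h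
      exact ⟨n, p, fun _ => ⟨hn, hp⟩⟩
    · exact ⟨0, fun _ => x, fun h => absurd h hi⟩
  choose n p hp using hp
  have hne : ∀ i i' a a', i < N → i' < N → i ≠ i' → 0 < a → a ≤ l → 0 < a' → a' ≤ l →
      p i a ≠ p i' a' := by
    intro i i' a a' hi hi' hii ha hal ha' hal' heq
    obtain ⟨h1, h2, h3, h4, h5⟩ := hp i hi
    obtain ⟨h1', -, -, -, h5'⟩ := hp i' hi'
    have hmem : p i a ∈ P i ∩ P i' :=
      ⟨h5 ▸ ⟨a, by simp; omega, rfl⟩, h5' ▸ ⟨a', by simp; omega, heq.symm⟩⟩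
    rw [hdisj _ (hP𝓟 i hi) _ (hP𝓟 i' hi') fun h => hii (hPinj hi hi' h)] at hmem
    rcases hmem with h | h
    · have := (h2 a (by omega) 0 (by omega)).1 (h.trans h3.symm); omega
    · have := (h2 a (by omega) (n i) le_rfl).1 (h.trans h4.symm); omega
  -- Only diagonal labels are valid, so different legs have incomparable labels. The shift `a + 1`
  -- skips the common start `x`, and `l < n` keeps `y` off the legs.
  obtain ⟨Y, hY, hYc, hhom⟩ := hN G hK hB (fun i _ a => p i (a + 1)) (fun i j _ => i = j) (by
    rintro i j a i' j' a' - hj - hj' ha ha' rfl rfl heq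
    by_contra hcon
    exact hne i i' _ _ hj hj' (fun h => hcon ⟨h, h⟩) (by omega) (by omega) (by omega) (by omega) heq)
  have hYN : ∀ i, Y.orderEmbOfFin hYc i < N := fun i =>
    Finset.mem_range.mp (hY (Finset.orderEmbOfFin_mem _ _ _))
  refine ⟨fun i => p (Y.orderEmbOfFin hYc i), fun i => ⟨?_, (hp _ (hYN i)).2.2.1⟩, ?_⟩
  · obtain ⟨h1, h2, -⟩ := hp _ (hYN i)
    exact fun a ha a' ha' => h2 a (by omega) a' (by omega)
  · intro i j hij a a' ha hal ha' hal'
    have hij' : Y.orderEmbOfFin hYc i ≠ Y.orderEmbOfFin hYc j := fun h =>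
      hij ((Y.orderEmbOfFin hYc).injective h)
    refine ⟨hne _ _ _ _ (hYN i) (hYN j) hij' ha hal ha' hal', ?_⟩
    have hi := Finset.orderEmbOfFin_mem Y hYc i
    have hj := Finset.orderEmbOfFin_mem Y hYc j
    have := hhom _ hi _ hi _ hj _ hj le_rfl le_rfl (by simpa using hij') (by simpa using hij'.symm)
      (a - 1) (by omega) (a' - 1) (by omega) rfl rfl
    rwa [Nat.sub_add_cancel ha, Nat.sub_add_cancel ha'] at this

/-- Subdivided stars at vertices that are far apart form an induced star forest. -/
theorem hasPlantedStarForest_of_legs {V : Type*} {G : SimpleGraph V} {θ δ l : ℕ} {S : Set V}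
    (x : Fin θ → V) (hxS : ∀ c, x c ∈ S)
    (hfar : ∀ c c', c ≠ c' → ∀ w : G.Walk (x c) (x c'), 2 * l + 1 < w.length)
    (leg : Fin θ → Fin δ → ℕ → V) (hleg : ∀ c i, IsPathFun G l (leg c i) ∧ leg c i 0 = x c)
    (hanti : ∀ c i j, i ≠ j → ∀ a a', 0 < a → a ≤ l → 0 < a' → a' ≤ l →
      leg c i a ≠ leg c j a' ∧ ¬ G.Adj (leg c i a) (leg c j a')) :
    HasPlantedStarForest θ δ l G S := by
  set f : Fin θ × Option (Fin δ × Fin l) → V := fun v =>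
    match v with
    | (c, none) => x c
    | (c, some (i, j)) => leg c i (j + 1) with hf
  have hwalk : ∀ c o, ∃ w : G.Walk (x c) (f (c, o)), w.length ≤ l := by
    rintro c (_ | ⟨i, j⟩)
    · exact ⟨.nil, by simp⟩
    · obtain ⟨h1, h2⟩ := hleg c i
      obtain ⟨w, hw, -⟩ := exists_walk_of_adj (j + 1) (leg c i) fun a ha => h1.adj (by omega)
      exact ⟨w.copy h2 rfl, by rw [SimpleGraph.Walk.length_copy, hw]; omega⟩
  -- A coincidence or an edge between two stars would join their centres by a walk of length at most
  -- `l + 1 + l`.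
  have hnear : ∀ c c' o o', c ≠ c' → f (c, o) ≠ f (c', o') ∧ ¬ G.Adj (f (c, o)) (f (c', o')) := by
    intro c c' o o' hc
    obtain ⟨w, hw⟩ := hwalk c o
    obtain ⟨w', hw'⟩ := hwalk c' o'
    refine ⟨fun h => ?_, fun h => ?_⟩
    · have := hfar c c' hc (w.append (w'.reverse.copy h.symm rfl))
      simp at this
      omega
    · have := hfar c c' hc (w.append (.cons h w'.reverse))
      simp at this
      omega
  have hsame : ∀ c o o', (f (c, o) = f (c, o') → o = o') ∧
      (G.Adj (f (c, o)) (f (c, o')) ↔ (starForest θ δ l).Adj (c, o) (c, o')) := by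
    rintro c (_ | ⟨i, j⟩) (_ | ⟨i', j'⟩)
    · simp
    · obtain ⟨h1, h2⟩ := hleg c i'
      have h3 := h1 0 (by omega) (j' + 1) (by omega)
      rw [h2] at h3
      simp only [hf, starForest, SimpleGraph.fromRel_adj]
      refine ⟨fun h => ?_, h3.2.trans ?_⟩
      · have := h3.1 h; omega
      · simp
    · obtain ⟨h1, h2⟩ := hleg c i
      have h3 := h1 (j + 1) (by omega) 0 (by omega)
      rw [h2] at h3
      simp only [hf, starForest, SimpleGraph.fromRel_adj]
      refine ⟨fun h => ?_, h3.2.trans ?_⟩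
      · have := h3.1 h; omega
      · simp
    · simp only [hf, starForest, SimpleGraph.fromRel_adj]
      by_cases hi : i = i'
      · subst hi
        have h3 := (hleg c i).1 (j + 1) (by omega) (j' + 1) (by omega)
        refine ⟨fun h => ?_, h3.2.trans ?_⟩
        · have := h3.1 h
          simp [Fin.ext_iff]; omega
        · simp [Fin.ext_iff]; omega
      · have h3 := hanti c i i' hi (j + 1) (j' + 1) (by omega) (by omega) (by omega) (by omega)
        exact ⟨fun h => absurd h h3.1, by simp [h3.2, hi, Ne.symm hi]⟩
  refine ⟨⟨⟨f, ?_⟩, ?_⟩, hxS⟩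
  · rintro ⟨c, o⟩ ⟨c', o'⟩ h
    by_cases hc : c = c'
    · subst hc
      rw [(hsame c o o').1 h]
    · exact absurd h (hnear c c' o o' hc).1
  · rintro ⟨c, o⟩ ⟨c', o'⟩
    by_cases hc : c = c'
    · subst hc
      exact (hsame c o o').2
    · refine iff_of_false (hnear c c' o o' hc).2 ?_
      simp [starForest, hc, Ne.symm hc]

/-! ### Hubs and long holes -/

/-- An induced path of length `n ≥ 1` and a vertex whose neighbours on it are its two ends form an
induced cycle. -/
theorem cycleGraph_isIndContained_of_pathFun {V : Type*} {G : SimpleGraph V} {n : ℕ} {r : ℕ → V}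
    {y : V} (hr : IsPathFun G n r) (hn : 1 ≤ n) (hy : ∀ a ≤ n, r a ≠ y)
    (hadj : ∀ a ≤ n, G.Adj (r a) y ↔ a = 0 ∨ a = n) :
    SimpleGraph.cycleGraph (n + 2) ⊴ G := by
  have hsub : ∀ i j : Fin (n + 2),
      (i - j).val = 1 ↔ j.val + 1 = i.val ∨ i.val = 0 ∧ j.val = n + 1 := by
    intro i j
    rw [Fin.val_sub]
    rcases le_or_gt j.val i.val with h | h
    · rw [show n + 2 - j.val + i.val = (i.val - j.val) + (n + 2) by omega, Nat.add_mod_right,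
        Nat.mod_eq_of_lt (by omega)]
      omega
    · rw [Nat.mod_eq_of_lt (by omega)]
      omega
  refine isIndContained_of_fun (fun i : Fin (n + 2) => if i.val ≤ n then r i else y) ?_ ?_
  · intro i j h
    ext
    by_cases hi : i.val ≤ n <;> by_cases hj : j.val ≤ n <;> simp only [hi, hj, if_true, if_false] at h
    · exact (hr _ hi _ hj).1 h
    · exact absurd h (hy _ hi)
    · exact absurd h.symm (hy _ hj)
    · omega
  · intro i j
    rw [SimpleGraph.cycleGraph_adj', hsub, hsub]
    by_cases hi : i.val ≤ n <;> by_cases hj : j.val ≤ n <;> simp only [hi, hj, if_true, if_false]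
    · rw [(hr _ hi _ hj).2]; omega
    · rw [hadj _ hi]; omega
    · rw [G.adj_comm, hadj _ hj]; omega
    · simp only [SimpleGraph.irrefl, false_iff]; omega

/-- From many short walks that start at `z` and have different ends one obtains many short walks
that start at a common vertex and are disjoint otherwise. -/
theorem exists_hub (m s : ℕ) : ∃ N : ℕ, ∀ {V : Type u} (G : SimpleGraph V) (z : V) (u : ℕ → V)
    (T : ℕ → Set V) (J : Finset ℕ), N ≤ J.card → Set.InjOn u J →
    (∀ j ∈ J, ∃ w : G.Walk z (u j), w.length ≤ s ∧ ∀ a ∈ w.support, a ∈ T j) →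
    ∃ (z' : V) (J' : Finset ℕ) (R : ℕ → Set V), J' ⊆ J ∧ J'.card = m ∧ (∀ j ∈ J', R j ⊆ T j) ∧
      (∀ j ∈ J', ∃ w : G.Walk z' (u j), w.length ≤ s ∧ ∀ a ∈ w.support, a ∈ R j) ∧
      ∀ i ∈ J', ∀ j ∈ J', i ≠ j → R i ∩ R j ⊆ {z'} := by
  classical
  induction s with
  | zero =>
    refine ⟨2, fun G z u T J hJ hu hw => ?_⟩
    obtain ⟨i, hi, j, hj, hij⟩ := Finset.one_lt_card.mp (show 1 < J.card by omega)
    obtain ⟨w, hw1, -⟩ := hw i hi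
    obtain ⟨w', hw1', -⟩ := hw j hj
    have h1 := SimpleGraph.Walk.eq_of_length_eq_zero (Nat.le_zero.mp hw1)
    have h2 := SimpleGraph.Walk.eq_of_length_eq_zero (Nat.le_zero.mp hw1')
    exact absurd (hu hi hj (h1.symm.trans h2)) hij
  | succ s ih =>
    obtain ⟨N, hN⟩ := ih
    -- Fewer than `m` walks in a maximal disjoint family cover at most `m * (s + 2)` vertices; the
    -- remaining walks are enough for `N` of them to pass through one of these.
    refine ⟨m + m * (s + 2) * N + 1, fun {V} G z u T J hJ hu hw => ?_⟩
    have hw' : ∀ j, ∃ L : List V, j ∈ J → ∃ w : G.Walk z (u j), w.support = L ∧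
        w.length ≤ s + 1 ∧ ∀ a ∈ w.support, a ∈ T j := by
      intro j
      by_cases hj : j ∈ J
      · obtain ⟨w, h⟩ := hw j hj
        exact ⟨w.support, fun _ => ⟨w, rfl, h⟩⟩
      · exact ⟨[], fun h => absurd h hj⟩
    choose L hL using hw'
    -- a maximal subfamily that is pairwise disjoint outside `z`
    obtain ⟨K, hK, hKmax⟩ := Finset.exists_max_image
      (J.powerset.filter fun K => ∀ i ∈ K, ∀ j ∈ K, i ≠ j → ∀ a ∈ L i, a ∈ L j → a = z)
      Finset.card ⟨∅, by simp⟩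
    simp only [Finset.mem_filter, Finset.mem_powerset] at hK hKmax
    by_cases hmK : m ≤ K.card
    · obtain ⟨J', hJ', hJ'c⟩ := Finset.exists_subset_card_eq hmK
      refine ⟨z, J', fun j => {a | a ∈ L j}, hJ'.trans hK.1, hJ'c, ?_, ?_, ?_⟩
      · intro j hj a ha
        obtain ⟨w, hwL, -, hwT⟩ := hL j (hK.1 (hJ' hj))
        exact hwT a (hwL ▸ ha)
      · intro j hj
        obtain ⟨w, hwL, hws, -⟩ := hL j (hK.1 (hJ' hj))
        exact ⟨w, hws, fun a ha => by rw [hwL] at ha; exact ha⟩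
      · intro i hi j hj hij a ha
        exact hK.2 i (hJ' hi) j (hJ' hj) hij a ha.1 ha.2
    push Not at hmK
    set X : Finset V := K.biUnion fun i => (L i).toFinset with hX
    have hXc : X.card ≤ m * (s + 2) := by
      refine (Finset.card_biUnion_le_card_mul _ _ (s + 2) fun i hi => ?_).trans
        (Nat.mul_le_mul_right _ hmK.le)
      obtain ⟨w, hwL, hws, -⟩ := hL i (hK.1 hi)
      refine (List.toFinset_card_le _).trans ?_
      rw [← hwL, SimpleGraph.Walk.length_support]
      omega
    have hmeet : ∀ j, ∃ a, j ∈ J \ K → a ∈ X ∧ a ∈ L j ∧ a ≠ z := by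
      intro j
      by_cases hj : j ∈ J \ K
      · obtain ⟨hjJ, hjK⟩ := Finset.mem_sdiff.mp hj
        by_contra hcon
        push Not at hcon
        have hins := hKmax (insert j K) ⟨Finset.insert_subset hjJ hK.1, ?_⟩
        · rw [Finset.card_insert_of_notMem hjK] at hins
          omega
        · have hz : ∀ i ∈ K, ∀ a ∈ L i, a ∈ L j → a = z := by
            intro i hi a hai haj
            exact (hcon a).2 (Finset.mem_biUnion.mpr ⟨i, hi, by simpa using hai⟩) haj
          intro i hi i' hi' hii a ha ha'
          rcases Finset.mem_insert.mp hi with rfl | hiK <;>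
            rcases Finset.mem_insert.mp hi' with rfl | hi'K
          · exact absurd rfl hii
          · exact hz i' hi'K a ha' ha
          · exact hz i hiK a ha ha'
          · exact hK.2 i hiK i' hi'K hii a ha ha'
      · exact ⟨z, fun h => absurd h hj⟩
    choose a ha using hmeet
    have hcard : m * (s + 2) * N + 1 ≤ (J \ K).card := by
      have := Finset.le_card_sdiff K J
      omega
    have hne : (J \ K).Nonempty := Finset.card_pos.mp (by omega)
    obtain ⟨v, hvX, hv⟩ := Finset.exists_le_card_fiber_of_mul_le_card_of_maps_to (s := J \ K)
      (t := X) (f := a) (n := N) (fun j hj => (ha j hj).1)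
      (hne.elim fun j hj => ⟨_, (ha j hj).1⟩)
      ((Nat.mul_le_mul_right N hXc).trans (by omega))
    have hsubJ : (J \ K).filter (fun j => a j = v) ⊆ J :=
      (Finset.filter_subset _ _).trans Finset.sdiff_subset
    -- As `v ≠ z`, the tails from `v` are at least one step shorter, so the induction on the length
    -- bound applies with `v` as the start.
    obtain ⟨z', J', R, h1, h2, h3, h4, h5⟩ := hN G v u T ((J \ K).filter fun j => a j = v) hv
      (hu.mono hsubJ) (by
        intro j hj
        obtain ⟨hjJ, rfl⟩ := Finset.mem_filter.mp hj
        obtain ⟨w, hwL, hws, hwT⟩ := hL j (hsubJ hj)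
        obtain ⟨-, haL, haz⟩ := ha j hjJ
        have haw : a j ∈ w.support := hwL ▸ haL
        refine ⟨w.dropUntil _ haw, ?_, fun b hb =>
          hwT b (w.support_dropUntil_subset_support haw hb)⟩
        have hsum : (w.takeUntil _ haw).length + (w.dropUntil _ haw).length = w.length := by
          rw [← SimpleGraph.Walk.length_append, SimpleGraph.Walk.take_spec]
        have hpos : (w.takeUntil _ haw).length ≠ 0 := fun h =>
          haz (SimpleGraph.Walk.eq_of_length_eq_zero h).symm
        omega)
    refine ⟨z', J', R, h1.trans hsubJ, h2, h3, fun j hj => ?_, h5⟩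
    obtain ⟨w, hw1, hw2⟩ := h4 j hj
    exact ⟨w, by omega, hw2⟩

/-- If vertices `u i ∈ W i` are pairwise joined by short walks inside `W i ∪ W j`, then there are
vertices `z i ∈ W i` for `i ∈ I` each of which is joined to a common large set of the `u j` by short
walks that are disjoint outside `z i`. -/
theorem exists_common_hubs (l m : ℕ) (hm : 2 ≤ m) (r : ℕ) : ∃ N : ℕ, ∀ {V : Type u}
    (G : SimpleGraph V) (u : ℕ → V) (W : ℕ → Set V) (I J : Finset ℕ), I.card = r → N ≤ J.card →
    Set.InjOn u J →
    (∀ i ∈ I, ∀ j ∈ J, ∃ w : G.Walk (u i) (u j), w.length ≤ l ∧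
      ∀ a ∈ w.support, a ∈ W i ∪ W j) →
    (∀ j ∈ J, ∀ j' ∈ J, j ≠ j' → Disjoint (W j) (W j')) →
    ∃ (z : ℕ → V) (J' : Finset ℕ) (R : ℕ → ℕ → Set V), J' ⊆ J ∧ J'.card = m ∧
      ∀ i ∈ I, z i ∈ W i ∧
        (∀ j ∈ J', ∃ w : G.Walk (z i) (u j), w.length ≤ l ∧ ∀ a ∈ w.support, a ∈ R i j) ∧
        ∀ j ∈ J', ∀ j' ∈ J', j ≠ j' → R i j ∩ R i j' ⊆ {z i} := by
  classical
  induction r with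
  | zero =>
    refine ⟨m, fun G u W I J hI hJ _ _ _ => ?_⟩
    obtain ⟨J', hJ', hJ'c⟩ := Finset.exists_subset_card_eq hJ
    refine ⟨u, J', fun _ _ => ∅, hJ', hJ'c, ?_⟩
    rw [Finset.card_eq_zero.mp hI]
    simp
  | succ r ih =>
    obtain ⟨N, hN⟩ := ih
    obtain ⟨N', hN'⟩ := exists_hub.{u} N l
    refine ⟨N', fun {V} G u W I J hI hJ hu hw hW => ?_⟩
    obtain ⟨i, I₀, hi, rfl, hI₀⟩ := Finset.card_eq_succ.mp hI
    -- The hub for `i` keeps `N` targets, enough to treat the remaining members of `I` inside them.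
    obtain ⟨z₀, J₁, R₀, hJ₁, hJ₁c, hR₀, hz₀, hdisj⟩ := hN' G (u i) u (fun j => W i ∪ W j) J hJ hu
      fun j hj => hw i (Finset.mem_insert_self _ _) j hj
    obtain ⟨z, J', R, hJ', hJ'c, hz⟩ := hN G u W I₀ J₁ hI₀ hJ₁c.ge (hu.mono hJ₁)
      (fun i' hi' j hj => hw i' (Finset.mem_insert_of_mem hi') j (hJ₁ hj))
      (fun j hj j' hj' => hW j (hJ₁ hj) j' (hJ₁ hj'))
    refine ⟨Function.update z i z₀, J', Function.update R i R₀, hJ'.trans hJ₁, hJ'c, ?_⟩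
    intro i' hi'
    rcases Finset.mem_insert.mp hi' with rfl | hi'
    · rw [Function.update_self, Function.update_self]
      refine ⟨?_, fun j hj => hz₀ j (hJ' hj), fun j hj j' hj' => hdisj j (hJ' hj) j' (hJ' hj')⟩
      -- The hub lies in `W i ∪ W j` for every remaining `j`. Two of these `W j` are disjoint, which
      -- forces it into `W i`; this is where `2 ≤ m` enters.
      obtain ⟨j, hj, j', hj', hjj⟩ := Finset.one_lt_card.mp (show 1 < J'.card by omega)
      have hmem : ∀ j ∈ J', z₀ ∈ W i' ∪ W j := by
        intro j hj
        obtain ⟨w, -, hwR⟩ := hz₀ j (hJ' hj)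
        exact hR₀ j (hJ' hj) (hwR _ w.start_mem_support)
      rcases hmem j hj with h | h
      · exact h
      rcases hmem j' hj' with h' | h'
      · exact h'
      exact absurd h' (Set.disjoint_left.mp (hW j (hJ₁ (hJ' hj)) j' (hJ₁ (hJ' hj')) hjj) h)
    · have hne : i' ≠ i := fun h => hi (h ▸ hi')
      rw [Function.update_of_ne hne, Function.update_of_ne hne]
      exact hz i' hi'

/-- In a graph without long holes, internally disjoint paths between vertices `x` and `y` that are
far apart have penultimate vertices that are pairwise joined by short walks inside the two
paths. -/
theorem exists_short_walk_of_not_hasHole {V : Type*} {G : SimpleGraph V} {l : ℕ} (hl : 0 < l)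
    (hG : ¬ HasHoleLongerThan l G) {x y : V} (hfar : ∀ w : G.Walk x y, l + 1 < w.length)
    {n n' : ℕ} {p p' : ℕ → V} (hp : IsPathFun G n p) (hp0 : p 0 = x) (hpn : p n = y)
    (hp' : IsPathFun G n' p') (hp0' : p' 0 = x) (hpn' : p' n' = y) :
    ∃ w : G.Walk (p (n - 1)) (p' (n' - 1)), w.length ≤ l ∧
      ∀ a ∈ w.support, a ∈ p '' Set.Ioo 0 n ∪ p' '' Set.Ioo 0 n' := by
  have hlong : ∀ {n : ℕ} {p : ℕ → V}, IsPathFun G n p → p 0 = x → p n = y → l + 1 < n := by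
    rintro n p hp rfl rfl
    obtain ⟨w, hw, -⟩ := hp.exists_walk
    exact hw ▸ hfar w
  have hn := hlong hp hp0 hpn
  have hn' := hlong hp' hp0' hpn'
  set T : Set V := {a | a = x ∨ a ∈ p '' Set.Ioo 0 n ∨ a ∈ p' '' Set.Ioo 0 n'} with hT
  have hpre : ∀ {n : ℕ} {p : ℕ → V}, IsPathFun G n p → p 0 = x → l + 1 < n →
      (∀ a ∈ p '' Set.Ioo 0 n, a ∈ T) →
      ∃ w : G.Walk x (p (n - 1)), ∀ a ∈ w.support, a ∈ T := by
    rintro n p hp rfl hn hpT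
    obtain ⟨w, hw, hwv⟩ := exists_walk_of_adj (n - 1) p fun i hi => hp.adj (by omega)
    refine ⟨w, fun a ha => ?_⟩
    obtain ⟨i, hi, rfl⟩ := w.mem_support_iff_getVert.mp ha
    rw [hw] at hi
    rw [hwv i hi]
    rcases Nat.eq_zero_or_pos i with rfl | h0
    · exact Or.inl rfl
    · exact hpT _ ⟨i, ⟨h0, by omega⟩, rfl⟩
  obtain ⟨w, hwT⟩ := hpre hp hp0 hn fun a ha => Or.inr (Or.inl ha)
  obtain ⟨w', hwT'⟩ := hpre hp' hp0' hn' fun a ha => Or.inr (Or.inr ha)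
  obtain ⟨m, -, r, hr, hr0, hrm, hrT⟩ := exists_pathFun_of_walk (w.reverse.append w') T (by
    intro a ha
    rcases (SimpleGraph.Walk.mem_support_append_iff _ _).mp ha with h | h
    · exact hwT a (by simpa using h)
    · exact hwT' a h)
  have hxy : ¬ G.Adj x y := fun h => by
    have := hfar h.toWalk
    simp at this
  have hnbr : ∀ {n : ℕ} {p : ℕ → V}, IsPathFun G n p → p n = y → ∀ a ∈ p '' Set.Ioo 0 n,
      a ≠ y ∧ (G.Adj a y → a = p (n - 1)) := by
    rintro n p hp rfl _ ⟨i, ⟨hi0, hin⟩, rfl⟩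
    refine ⟨fun h => ?_, fun h => ?_⟩
    · have := (hp i hin.le n le_rfl).1 h; omega
    · have := (hp i hin.le n le_rfl).2.mp h
      rw [show i = n - 1 by omega]
  have hlast : ∀ {n : ℕ} {p : ℕ → V}, IsPathFun G n p → p n = y → l + 1 < n →
      G.Adj (p (n - 1)) y := by
    rintro n p hp rfl hn
    exact (hp (n - 1) (by omega) n le_rfl).2.mpr (by omega)
  -- Within `T` the only neighbours of `y` are the two penultimate vertices, so `y` closes `r` to an
  -- induced cycle of length `m + 2`. If `m > l`, then `m ≥ 2` and this cycle is a long hole.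
  have hml : m ≤ l := by
    by_contra hml
    refine hG ⟨m + 2, by omega, by omega, cycleGraph_isIndContained_of_pathFun (y := y) hr (by omega)
      (fun a ha h => ?_) (fun a ha => ⟨fun h => ?_, ?_⟩)⟩
    · rcases hrT a ha with h' | h' | h'
      · have := hfar (SimpleGraph.Walk.nil.copy rfl (h'.symm.trans h))
        simp at this
      · exact (hnbr hp hpn _ h').1 h
      · exact (hnbr hp' hpn' _ h').1 h
    · rcases hrT a ha with h' | h' | h'
      · exact absurd (h' ▸ h) hxy
      · exact Or.inl ((hr a ha 0 (by omega)).1 (((hnbr hp hpn _ h').2 h).trans hr0.symm))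
      · exact Or.inr ((hr a ha m le_rfl).1 (((hnbr hp' hpn' _ h').2 h).trans hrm.symm))
    · rintro (rfl | rfl)
      · rw [hr0]; exact hlast hp hpn hn
      · rw [hrm]; exact hlast hp' hpn' hn'
  -- If `r` met `x`, its tail followed by `y` would be a walk from `x` to `y` of length at most `l +
  -- 1`.
  have hrx : ∀ a ≤ m, r a ≠ x := by
    rintro a ha rfl
    obtain ⟨v, hv, -⟩ := exists_walk_of_adj (m - a) (fun i => r (a + i))
      fun i hi => hr.adj (i := a + i) (by omega)
    have hend : G.Adj (r (a + (m - a))) y := by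
      rw [Nat.add_sub_cancel' ha, hrm]; exact hlast hp' hpn' hn'
    have := hfar (v.concat hend)
    rw [SimpleGraph.Walk.length_concat, hv] at this
    omega
  obtain ⟨v, hv, hvr⟩ := hr.exists_walk
  refine ⟨v.copy hr0 hrm, by simpa [hv] using hml, fun a ha => ?_⟩
  rw [SimpleGraph.Walk.support_copy, SimpleGraph.Walk.mem_support_iff_getVert] at ha
  obtain ⟨i, hi, rfl⟩ := ha
  rw [hv] at hi
  rw [hvr i hi]
  exact (hrT i hi).resolve_left (hrx i hi)

/-- Many internally disjoint paths between two vertices that are far apart force a long hole in a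
`t`-clean graph. -/
theorem exists_hasHole_of_paths (t l : ℕ) (hl : 0 < l) : ∃ k : ℕ, ∀ {V : Type u}
    (G : SimpleGraph V), IsTClean t G → ∀ (x y : V) (𝓟 : Fin k → Set V),
      (∀ w : G.Walk x y, l + 1 < w.length) → (∀ i, ∃ n, IsInducedPath G x y n (𝓟 i)) →
      (∀ i j, i ≠ j → 𝓟 i ∩ 𝓟 j = {x, y}) → HasHoleLongerThan l G := by
  classical
  obtain ⟨r, M, hrM⟩ := exists_bound_of_robustlyLinked.{u} (wall t) t (2 * l)
  -- The first `r` paths carry the hubs and the other `N` the targets. Two hubs lose at most `2 * M`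
  -- targets, and `2 * M + 2` also ensures two targets when `M = 0`.
  obtain ⟨N, hN⟩ := exists_common_hubs.{u} l (2 * M + 2) (by omega) r
  refine ⟨r + N, fun {V} G hG x y 𝓟 hfar hpath hdisj => ?_⟩
  by_contra hhole
  have hp : ∀ i : ℕ, ∃ (n : ℕ) (p : ℕ → V), ∀ hi : i < r + N, IsPathFun G n p ∧ p 0 = x ∧
      p n = y ∧ 𝓟 ⟨i, hi⟩ = p '' Set.Iic n := by
    intro i
    by_cases hi : i < r + N
    · obtain ⟨n, h⟩ := hpath ⟨i, hi⟩
      obtain ⟨p, hp⟩ := isInducedPath_iff.mp h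
      exact ⟨n, p, fun _ => hp⟩
    · exact ⟨0, fun _ => x, fun h => absurd h hi⟩
  choose n p hp using hp
  have hlong : ∀ i < r + N, l + 1 < n i := by
    intro i hi
    obtain ⟨h1, h2, h3, -⟩ := hp i hi
    obtain ⟨w, hw, -⟩ := h1.exists_walk
    have := hfar (w.copy h2 h3)
    simpa [hw] using this
  set W : ℕ → Set V := fun i => p i '' Set.Ioo 0 (n i) with hW
  have hWdisj : ∀ i < r + N, ∀ j < r + N, i ≠ j → Disjoint (W i) (W j) := by
    intro i hi j hj hij
    rw [Set.disjoint_left]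
    rintro _ ⟨a, ⟨ha0, han⟩, rfl⟩ ⟨a', ⟨ha0', han'⟩, heq⟩
    obtain ⟨h1, h2, h3, h4⟩ := hp i hi
    obtain ⟨-, -, -, h4'⟩ := hp j hj
    have hmem : p i a ∈ 𝓟 ⟨i, hi⟩ ∩ 𝓟 ⟨j, hj⟩ :=
      ⟨h4 ▸ ⟨a, han.le, rfl⟩, h4' ▸ ⟨a', han'.le, heq⟩⟩
    rw [hdisj _ _ (by simpa using hij)] at hmem
    rcases hmem with h | h
    · have := (h1 a han.le 0 (by omega)).1 (h.trans h2.symm); omega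
    · have := (h1 a han.le (n i) le_rfl).1 (h.trans h3.symm); omega
  have huW : ∀ i < r + N, p i (n i - 1) ∈ W i := fun i hi => by
    have := hlong i hi
    exact ⟨n i - 1, ⟨by omega, by omega⟩, rfl⟩
  have hJ : ∀ j ∈ Finset.Ico r (r + N), j < r + N := fun j hj => (Finset.mem_Ico.mp hj).2
  obtain ⟨z, J', R, hJ', hJ'c, hz⟩ := hN G (fun i => p i (n i - 1)) W (Finset.range r)
    (Finset.Ico r (r + N)) (by simp) (by simp)
    (by
      intro i hi j hj heq
      by_contra hij
      have hi' := hJ i (by simpa using hi)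
      have hj' := hJ j (by simpa using hj)
      refine Set.disjoint_left.mp (hWdisj i hi' j hj' hij) (huW i hi') ?_
      rw [show p i (n i - 1) = p j (n j - 1) from heq]
      exact huW j hj')
    (by
      intro i hi j hj
      obtain ⟨h1, h2, h3, -⟩ := hp i (by simp at hi; omega)
      obtain ⟨h1', h2', h3', -⟩ := hp j (hJ j hj)
      exact exists_short_walk_of_not_hasHole hl hhole hfar h1 h2 h3 h1' h2' h3')
    (fun j hj j' hj' => hWdisj j (hJ j hj) j' (hJ j' hj'))
  refine hrM G hG.1 hG.2.1 (fun m H hH => (hG.2.2 m H hH).1) z ?_ ?_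
  · intro i hi j hj heq
    by_contra hij
    simp only [Set.mem_Iio] at hi hj
    exact Set.disjoint_left.mp (hWdisj i (by omega) j (by omega) hij)
      (hz i (by simpa using hi)).1 (heq ▸ (hz j (by simpa using hj)).1)
  · intro i i' hii hi' Z hZ hiZ hiZ'
    -- The sets `R i j` meet only in `z i`, which is not in `Z`, so each vertex of `Z` spoils at
    -- most one target.
    have hbad : ∀ i < r, z i ∉ Z → (J'.filter fun j => ∃ a ∈ R i j, a ∈ Z).card ≤ M := by
      intro i hi hiZ
      obtain ⟨-, -, h3⟩ := hz i (by simpa using hi)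
      have hch : ∀ j, ∃ a, (∃ a ∈ R i j, a ∈ Z) → a ∈ R i j ∧ a ∈ Z := by
        intro j
        by_cases h : ∃ a ∈ R i j, a ∈ Z
        · obtain ⟨a, ha⟩ := h
          exact ⟨a, fun _ => ha⟩
        · exact ⟨x, fun h' => absurd h' h⟩
      choose a ha using hch
      refine (Finset.card_le_card_of_injOn a (t := Z) (fun j hj => ?_) ?_).trans hZ
      · exact (ha j (Finset.mem_filter.mp hj).2).2
      · intro j hj j' hj' heq
        by_contra hjj
        obtain ⟨hj1, hj2⟩ := Finset.mem_filter.mp (Finset.mem_coe.mp hj)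
        obtain ⟨hj1', hj2'⟩ := Finset.mem_filter.mp (Finset.mem_coe.mp hj')
        have := h3 j hj1 j' hj1' hjj ⟨(ha j hj2).1, heq ▸ (ha j' hj2').1⟩
        exact hiZ (this ▸ (ha j hj2).2)
    have h1 := hbad i (by omega) hiZ
    have h2 := hbad i' hi' hiZ'
    obtain ⟨j, hj, hjn⟩ : ∃ j ∈ J', j ∉ (J'.filter fun j => ∃ a ∈ R i j, a ∈ Z) ∪
        (J'.filter fun j => ∃ a ∈ R i' j, a ∈ Z) := by
      refine Finset.exists_mem_notMem_of_card_lt_card ?_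
      have := Finset.card_union_le (J'.filter fun j => ∃ a ∈ R i j, a ∈ Z)
        (J'.filter fun j => ∃ a ∈ R i' j, a ∈ Z)
      omega
    simp only [Finset.mem_union, Finset.mem_filter, hj, true_and, not_or, not_exists, not_and] at hjn
    obtain ⟨w, hw1, hw2⟩ := (hz i (by simp; omega)).2.1 j hj
    obtain ⟨w', hw1', hw2'⟩ := (hz i' (by simpa using hi')).2.1 j hj
    refine ⟨w.append w'.reverse, by simp; omega, fun a ha => ?_⟩
    rcases (SimpleGraph.Walk.mem_support_append_iff _ _).mp ha with h | h
    · exact hjn.1 a (hw2 a h)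
    · exact hjn.2 a (hw2' a (by simpa using h))

/-! ### Assembly of the theorem -/

theorem IsStrongBlock.mono {V : Type*} {G : SimpleGraph V} {k k' : ℕ} {B : Set V} (h : k ≤ k')
    (hB : IsStrongBlock k' G B) : IsStrongBlock k G B := by
  have hk : (k : ℕ∞) ≤ k' := by exact_mod_cast h
  obtain ⟨h1, 𝓠, h2, h3⟩ := hB
  exact ⟨hk.trans h1, 𝓠, fun x hx y hy hxy => ⟨hk.trans (h2 x hx y hy hxy).1,
    (h2 x hx y hy hxy).2⟩, h3⟩

theorem exists_walk_of_walk_induce {V : Type*} {G : SimpleGraph V} {T : Set V} {x y : T}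
    (w : (G.induce T).Walk x y) :
    ∃ w' : G.Walk (x : V) y, w'.length = w.length ∧ ∀ z ∈ w'.support, z ∈ T := by
  induction w with
  | nil => exact ⟨.nil, rfl, by simp⟩
  | cons h w ih =>
    obtain ⟨w', hw, hwT⟩ := ih
    exact ⟨.cons (SimpleGraph.induce_adj.mp h) w', by simp [hw], by simpa using hwT⟩

/-- In a strong block whose vertices are far apart one finds planted star forests and long holes. -/
theorem exists_planted_and_hole (t δ l θ : ℕ) (hl : 0 < l) : ∃ k : ℕ, ∀ {V : Type u}
    (G : SimpleGraph V), IsTClean t G → ∀ S : Set V, IsStrongBlock k G S →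
      (∀ x ∈ S, ∀ y ∈ S, x ≠ y → ∀ w : G.Walk x y, 2 * l + 1 < w.length) →
      HasPlantedStarForest θ δ l G S ∧ HasHoleLongerThan l G := by
  classical
  obtain ⟨k₁, hk₁⟩ := exists_anticomplete_legs.{u} t δ l
  obtain ⟨k₂, hk₂⟩ := exists_hasHole_of_paths.{u} t l hl
  -- Here `k₁` paths serve the legs at a root and `k₂` paths the hole; `θ` vertices are the roots,
  -- and two vertices make every root an end of some path collection.
  refine ⟨max (max k₁ k₂) (max θ 2), fun {V} G hG S hS hfar => ?_⟩
  have hB₁ := hS.mono ((le_max_left k₁ k₂).trans (le_max_left _ (max θ 2)))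
  have hB₂ := hS.mono ((le_max_right k₁ k₂).trans (le_max_left _ (max θ 2)))
  have hθ := (hS.mono ((le_max_left θ 2).trans (le_max_right (max k₁ k₂) _))).1
  have h2 := (hS.mono ((le_max_right θ 2).trans (le_max_right (max k₁ k₂) _))).1
  have h1 : 1 < S.encard := lt_of_lt_of_le (by norm_num) h2
  obtain ⟨x₀, y₀, hx₀, hy₀, hxy₀⟩ := Set.one_lt_encard_iff.mp h1
  have : Nonempty V := ⟨x₀⟩
  constructor
  · obtain ⟨x, hxinj, hxS⟩ := exists_injOn_of_le_encard hθ
    have hleg : ∀ c : Fin θ, ∃ leg : Fin δ → ℕ → V, (∀ i, IsPathFun G l (leg i) ∧ leg i 0 = x c) ∧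
        ∀ i j, i ≠ j → ∀ a a', 0 < a → a ≤ l → 0 < a' → a' ≤ l →
          leg i a ≠ leg j a' ∧ ¬ G.Adj (leg i a) (leg j a') := by
      intro c
      obtain ⟨y, hyS, hyx⟩ := Set.exists_ne_of_one_lt_encard h1 (x c)
      obtain ⟨-, 𝓠, h𝓠, -⟩ := hB₁
      obtain ⟨h3, h4, h5⟩ := h𝓠 (x c) (hxS c c.2) y hyS hyx.symm
      refine hk₁ G hG.1 hG.2.1 (x c) y (𝓠 s(x c, y)) h3 (fun P hP => ?_) h5
      obtain ⟨n, hn⟩ := h4 P hP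
      refine ⟨n, ?_, hn⟩
      obtain ⟨w, -, -, rfl, -⟩ := hn
      have := hfar _ (hxS c c.2) y hyS hyx.symm w
      omega
    choose leg hleg hanti using hleg
    refine hasPlantedStarForest_of_legs (fun c => x c) (fun c => hxS c c.2) (fun c c' hc w => ?_)
      leg hleg hanti
    exact hfar _ (hxS c c.2) _ (hxS c' c'.2) (fun h => hc (Fin.ext (hxinj c.2 c'.2 h))) w
  · obtain ⟨-, 𝓠, h𝓠, -⟩ := hB₂
    obtain ⟨h3, h4, h5⟩ := h𝓠 x₀ hx₀ y₀ hy₀ hxy₀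
    obtain ⟨P, hPinj, hP⟩ := exists_injOn_of_le_encard h3
    refine hk₂ G hG x₀ y₀ (fun i => P i) (fun w => ?_) (fun i => h4 _ (hP i i.2)) fun i j hij =>
      h5 _ (hP i i.2) _ (hP j j.2) fun h => hij (Fin.ext (hPinj i.2 j.2 h))
    have := hfar x₀ hx₀ y₀ hy₀ hxy₀ w
    omega

theorem theorem8p1 (d k t δ l θ : ℕ) (hd : 0 < d) (hk : 0 < k) (ht : 0 < t) (hδ : 2 ≤ δ)
    (hl : 0 < l) (hθ : 0 < θ) :
    ∃ k₁ : ℕ, 0 < k₁ ∧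
      (∀ (V : Type u) [Finite V] (G : SimpleGraph V), IsTClean t G →
        ∀ B₁ : Set V, IsStrongBlock k₁ G B₁ →
          ∃ A S : Set V, S ⊆ B₁ \ A ∧
            IsStrongBlock k (G.induce Aᶜ) (Subtype.val ⁻¹' S) ∧
            IsDStable d (G.induce Aᶜ) (Subtype.val ⁻¹' S) ∧
            HasPlantedStarForest θ δ l (G.induce Aᶜ) (Subtype.val ⁻¹' S) ∧
            HasHoleLongerThan l (G.induce Aᶜ)) ∧
      (∀ (V : Type u) [Finite V] (G : SimpleGraph V), IsTClean t G →
        ¬ starForest θ δ l ⊴ G → ¬ ∃ B : Set V, IsStrongBlock k₁ G B) ∧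
      (∀ (V : Type u) [Finite V] (G : SimpleGraph V), IsTClean t G →
        ¬ HasHoleLongerThan l G → ¬ ∃ B : Set V, IsStrongBlock k₁ G B) := by
  classical
  obtain ⟨k', hk'⟩ := exists_planted_and_hole.{u} t δ l θ hl
  -- Distance more than `d` gives stability, and more than `2 * l + 1` gives the star forest and the
  -- hole.
  obtain ⟨N, m, hNm⟩ := exists_far_apart.{u} t (max d (2 * l + 1)) (max k k')
  -- The summand `m` pays for the paths lost with `A`; `N + 1` provides the `N` vertices to choose
  -- from and makes the block nonempty even if `N = 0`.
  have main : ∀ (V : Type u) (G : SimpleGraph V), IsTClean t G →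
      ∀ B₁ : Set V, IsStrongBlock (max (N + 1) (max k k' + m)) G B₁ →
        ∃ A S : Set V, S ⊆ B₁ \ A ∧
          IsStrongBlock k (G.induce Aᶜ) (Subtype.val ⁻¹' S) ∧
          IsDStable d (G.induce Aᶜ) (Subtype.val ⁻¹' S) ∧
          HasPlantedStarForest θ δ l (G.induce Aᶜ) (Subtype.val ⁻¹' S) ∧
          HasHoleLongerThan l (G.induce Aᶜ) := by
    intro V G hG B₁ hB₁
    have hcard := (hB₁.mono (le_max_left (N + 1) _)).1
    have hN : (N : ℕ∞) ≤ B₁.encard := le_trans (by exact_mod_cast N.le_succ) hcard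
    have hne : B₁.Nonempty := by
      rw [← Set.one_le_encard_iff_nonempty]
      exact le_trans (by exact_mod_cast Nat.le_add_left 1 N) hcard
    have : Nonempty V := ⟨hne.some⟩
    obtain ⟨b, hb, hbB⟩ := exists_injOn_of_le_encard hN
    obtain ⟨S, A, hSb, hSc, hAc, hSA, hfar⟩ := hNm G hG b hb
    have hSB : (S : Set V) ⊆ B₁ := by
      intro x hx
      obtain ⟨i, hi, rfl⟩ := hSb hx
      exact hbB i hi
    have hSA' : ∀ x ∈ (S : Set V), x ∉ A := fun x hx => Finset.disjoint_left.mp hSA hx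
    have hblock : IsStrongBlock (max k k') (G.induce (A : Set V)ᶜ) (Subtype.val ⁻¹' (S : Set V)) := by
      refine hB₁.induce_compl A hSB hSA' ?_ ((Nat.add_le_add_left hAc _).trans (le_max_right _ _))
      rw [Set.encard_coe_eq_coe_finsetCard, hSc]
    have hfar' : ∀ x ∈ (Subtype.val ⁻¹' (S : Set V) : Set ((A : Set V)ᶜ : Set V)),
        ∀ y ∈ (Subtype.val ⁻¹' (S : Set V) : Set ((A : Set V)ᶜ : Set V)), x ≠ y →
        ∀ w : (G.induce (A : Set V)ᶜ).Walk x y, max d (2 * l + 1) < w.length := by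
      intro x hx y hy hxy w
      obtain ⟨w', hw, hwT⟩ := exists_walk_of_walk_induce w
      exact hw ▸ hfar x hx y hy (fun h => hxy (Subtype.ext h)) w' fun z hz => hwT z hz
    refine ⟨A, S, fun x hx => ⟨hSB hx, hSA' x hx⟩, hblock.mono (le_max_left _ _), ?_,
      hk' _ (hG.induce _) _ (hblock.mono (le_max_right _ _)) fun x hx y hy hxy w =>
        (le_max_right _ _).trans_lt (hfar' x hx y hy hxy w)⟩
    rintro x hx y hy hxy ⟨ℓ, P, ⟨w, -, -, rfl, -⟩, hℓ⟩
    exact absurd ((le_max_left _ _).trans_lt (hfar' x hx y hy hxy w)) (not_lt.mpr hℓ)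
  refine ⟨max (N + 1) (max k k' + m), lt_max_of_lt_left N.succ_pos,
    fun V _ G hG B₁ hB₁ => main V G hG B₁ hB₁, ?_, ?_⟩
  · rintro V _ G hG hfree ⟨B, hB⟩
    obtain ⟨A, S, -, -, -, ⟨f, -⟩, -⟩ := main V G hG B hB
    exact hfree ⟨(SimpleGraph.Embedding.induce Aᶜ).comp f⟩
  · rintro V _ G hG hfree ⟨B, hB⟩
    obtain ⟨A, S, -, -, -, -, n, hn, hln, hc⟩ := main V G hG B hB
    exact hfree ⟨n, hn, hln, hc.trans ⟨SimpleGraph.Embedding.induce Aᶜ⟩⟩
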